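/- Tense formulas are built from variables $p_0,p_1,\dots$ with $\bot,\to,\Box,\blacklozenge$; write $\Diamond\varphi=\neg\Box\neg\varphi$. A frame is a pair $(X,R)$ with $X\neq\varnothing$ and $R\subseteq X\times X$. In a model on $(X,R)$, $\Box\varphi$ holds at $x$ iff $\varphi$ holds at all $y$ with $Rxy$, and $\blacklozenge\varphi$ holds at $x$ iff $\varphi$ holds at some $y$ with $Ryx$. $\mathsf{Log}(\mathfrak F)$ is the set of formulas valid in the frame $\mathfrak F$ (true at every point under every valuation). A tense logic is a set $L$ of formulas that contains all instances of classical tautologies, is closed under modus ponens and substitution, and satisfies: $\blacklozenge\varphi\to\psi\in L$ iff $\varphi\to\Box\psi\in L$. It is consistent if $\bot\notin L$, tabular if $L=\mathsf{Log}(\mathfrak F)$ for some finite frame $\mathfrak F$, and pretabular if it is consistent and not tabular while all its consistent proper extensions are tabular. $\mathsf{PTAB}(L)$ denotes the set of pretabular tense logics containing $L$. Let $\Delta^0\varphi=\varphi$ and $\Delta^{k+1}\varphi=\Delta^k\varphi\vee\Diamond\Delta^k\varphi\vee\blacklozenge\Delta^k\varphi$. Let $\mathsf{S4.3}_t$, the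 tense logic of linear (reflexive and transitive) frames, be the least tense logic containing $\Box p_0\to p_0$, $\ \Box p_0\to\Box\Box p_0$, $\ \Delta^2p_0\to\Delta p_0$, $\ \Diamond p_0\wedge\Diamond p_1\to\Diamond(p_0\wedge(p_1\vee\Diamond p_1))\vee\Diamond(p_1\wedge(p_0\vee\Diamond p_0))$ and $\ \blacklozenge p_0\wedge\blacklozenge p_1\to\blacklozenge(p_0\wedge(p_1\vee\blacklozenge p_1))\vee\blacklozenge(p_1\wedge(p_0\vee\blacklozenge p_0))$. For $n\ge 1$ let $\mathfrak C_n=(\{0,\dots,n-1\},\ge)$ and let $L^\uparrow=\bigcap_{n\ge1}\mathsf{Log}(\mathfrak C_n)$. For a point $x$ of a frame $\mathfrak F=(X,R)$, let $\mathfrak F^x_\omega$ be the frame obtained by adding a countably infinite set $N$ of new points to $X$ and taking, with $C=N\cup\{x\}$, the relation $R\cup(C\times R[x])\cup(\breve R[x]\times C)\cup(C\times C)$, where $R[x]=\{y:Rxy\}$ and $\breve R[x]=\{y:Ryx\}$. Put $L^\circ=\mathsf{Log}((\mathfrak C_1)^0_\omega)$, $L^+=\mathsf{Log}((\mathfrak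 C_2)^1_\omega)$, $L^-=\mathsf{Log}((\mathfrak C_2)^0_\omega)$ and $L^\pm=\mathsf{Log}((\mathfrak C_3)^1_\omega)$: the logics of an infinite cluster alone, followed by one reflexive point, preceded by one reflexive point, and both preceded and followed by one reflexive point, respectively. **Theorem.** $\mathsf{PTAB}(\mathsf{S4.3}_t)=\{L^\pm,L^+,L^-,L^\circ,L^\uparrow\}$ and $|\mathsf{PTAB}(\mathsf{S4.3}_t)|=5$. -/

import Mathlib

namespace TenseLogic

/-- Formulas of tense logic: variables `p_i`, falsum, implication, the future necessity `□`
(`box`) and the past possibility `⧫` (`pdia`). -/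
inductive Formula : Type where
  | var : ℕ → Formula
  | bot : Formula
  | imp : Formula → Formula → Formula
  | box : Formula → Formula
  | pdia : Formula → Formula

namespace Formula

def neg (φ : Formula) : Formula := imp φ bot

def disj (φ ψ : Formula) : Formula := imp (neg φ) ψ

def conj (φ ψ : Formula) : Formula := neg (imp φ (neg ψ))

/-- Future possibility `◇φ = ¬□¬φ`. -/
def dia (φ : Formula) : Formula := neg (box (neg φ))

/-- The substitution (homomorphism of the formula algebra) determined by `s`. -/
def subst (s : ℕ → Formula) : Formula → Formula
  | var i => s i
  | bot => bot
  | imp φ ψ => imp (subst s φ) (subst s ψ)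
  | box φ => box (subst s φ)
  | pdia φ => pdia (subst s φ)

/-- `φ` is an instance of a classical propositional tautology: it is true under every Boolean
assignment of truth values, where variables and formulas `□ψ`, `⧫ψ` are treated as atoms. -/
def IsTautology (φ : Formula) : Prop :=
  ∀ v : Formula → Prop, ¬ v bot → (∀ ψ χ, v (imp ψ χ) ↔ (v ψ → v χ)) → v φ

/-- `Δ⁰φ = φ`, `Δᵏ⁺¹φ = Δᵏφ ∨ ◇Δᵏφ ∨ ⧫Δᵏφ`. -/
def delta : ℕ → Formula → Formula
  | 0, φ => φ
  | k + 1, φ => disj (delta k φ) (disj (dia (delta k φ)) (pdia (delta k φ)))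

/-- `□p → p` -/
def axT : Formula := imp (box (var 0)) (var 0)

/-- `□p → □□p` -/
def ax4 : Formula := imp (box (var 0)) (box (box (var 0)))

/-- `Δⁿ⁺¹p → Δⁿp` (z-degree at most `n`). -/
def bz (n : ℕ) : Formula := imp (delta (n + 1) (var 0)) (delta n (var 0))

/-- Forth-width at most one:
`◇p₀ ∧ ◇p₁ → ◇(p₀ ∧ (p₁ ∨ ◇p₁)) ∨ ◇(p₁ ∧ (p₀ ∨ ◇p₀))`. -/
def bwForth : Formula :=
  imp (conj (dia (var 0)) (dia (var 1)))
    (disj (dia (conj (var 0) (disj (var 1) (dia (var 1)))))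
      (dia (conj (var 1) (disj (var 0) (dia (var 0))))))

/-- Back-width at most one:
`⧫p₀ ∧ ⧫p₁ → ⧫(p₀ ∧ (p₁ ∨ ⧫p₁)) ∨ ⧫(p₁ ∧ (p₀ ∨ ⧫p₀))`. -/
def bwBack : Formula :=
  imp (conj (pdia (var 0)) (pdia (var 1)))
    (disj (pdia (conj (var 0) (disj (var 1) (pdia (var 1)))))
      (pdia (conj (var 1) (disj (var 0) (pdia (var 0))))))

end Formula

open Formula

/-- Kripke frames: a nonempty set with a binary relation. -/
structure Frame where
  X : Type
  nonempty : Nonempty X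
  R : X → X → Prop

/-- The truth set of a formula under a valuation. -/
def truth (F : Frame) (V : ℕ → Set F.X) : Formula → Set F.X
  | .var i => V i
  | .bot => ∅
  | .imp φ ψ => (truth F V φ)ᶜ ∪ truth F V ψ
  | .box φ => {x | ∀ y, F.R x y → y ∈ truth F V φ}
  | .pdia φ => {x | ∃ y, F.R y x ∧ y ∈ truth F V φ}

/-- The tense logic of a frame: all formulas valid in it. -/
def Log (F : Frame) : Set Formula := {φ | ∀ V : ℕ → Set F.X, ∀ x, x ∈ truth F V φ}

/-- Normal tense logics. -/
structure IsTenseLogic (L : Set Formula) : Prop where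
  taut : ∀ φ, IsTautology φ → φ ∈ L
  adj : ∀ φ ψ, imp (pdia φ) ψ ∈ L ↔ imp φ (box ψ) ∈ L
  mp : ∀ φ ψ, φ ∈ L → imp φ ψ ∈ L → ψ ∈ L
  subst : ∀ φ, φ ∈ L → ∀ s : ℕ → Formula, φ.subst s ∈ L

/-- `L ⊕ S`: the smallest tense logic containing `L ∪ S`. -/
def oplus (L S : Set Formula) : Set Formula := ⋂₀ {L' | IsTenseLogic L' ∧ L ∪ S ⊆ L'}

/-- The least tense logic. -/
def Kt : Set Formula := ⋂₀ {L | IsTenseLogic L}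

def S4t : Set Formula := oplus Kt {ax4, axT}

/-- The tense logic of linear frames: `S4_t` with forth-width, back-width and z-degree at
most one and no bound on the depth. -/
def S43t : Set Formula := oplus S4t {bz 1, bwForth, bwBack}

def Consistent (L : Set Formula) : Prop := bot ∉ L

/-- The logic of a finite frame. -/
def IsTabular (L : Set Formula) : Prop := ∃ F : Frame, Finite F.X ∧ L = Log F

/-- Consistent and not tabular, while every consistent proper extension is tabular. -/
structure IsPretabular (L : Set Formula) : Prop where
  logic : IsTenseLogic L
  consistent : Consistent L
  not_tabular : ¬ IsTabular L
  extensions : ∀ L', IsTenseLogic L' → L ⊂ L' → Consistent L' → IsTabular L'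

/-- The set of pretabular logics among the extensions of `L`. -/
def PTAB (L : Set Formula) : Set (Set Formula) := {L' | L ⊆ L' ∧ IsPretabular L'}

/-- The chain with `n + 1` points: `{0, …, n}` with the relation `≥`. -/
abbrev chain (n : ℕ) : Frame where
  X := Fin (n + 1)
  nonempty := ⟨0⟩
  R i j := i ≥ j

/-- The frame obtained from `F` by adding countably infinitely many new points to the cluster
of `x`: with `C` consisting of `x` and the new points, the relation is
`R ∪ (C × R[x]) ∪ (R⁻¹[x] × C) ∪ (C × C)`. -/
def inflate (F : Frame) (x : F.X) : Frame where
  X := F.X ⊕ ℕ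
  nonempty := ⟨Sum.inl x⟩
  R a b :=
    let C : Set (F.X ⊕ ℕ) := {Sum.inl x} ∪ Set.range Sum.inr
    (∃ u v, a = Sum.inl u ∧ b = Sum.inl v ∧ F.R u v) ∨
    (a ∈ C ∧ ∃ v, b = Sum.inl v ∧ F.R x v) ∨
    ((∃ u, a = Sum.inl u ∧ F.R u x) ∧ b ∈ C) ∨
    (a ∈ C ∧ b ∈ C)

/-- The logic of the countably infinite cluster. -/
def Lcirc : Set Formula := Log (inflate (chain 0) (0 : Fin 1))

/-- The logic of an infinite cluster followed by a single reflexive point. -/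
def Lplus : Set Formula := Log (inflate (chain 1) (1 : Fin 2))

/-- The logic of a single reflexive point followed by an infinite cluster. -/
def Lminus : Set Formula := Log (inflate (chain 1) (0 : Fin 2))

/-- The logic of an infinite cluster between two single reflexive points. -/
def Lpm : Set Formula := Log (inflate (chain 2) (1 : Fin 3))

/-- The logic of all finite chains. -/
def Lup : Set Formula := ⋂ n : ℕ, Log (chain n)

end TenseLogic

/-! Two facts carry the classification. By `exists_subset_fiveLogics`, every consistent non-tabular
extension of `S43t` lies below one of the five logics. By `eq_of_fiveLogics_subset`, the five are
pairwise incomparable. A pretabular logic must then equal the one above it, which is not tabular;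
and a non-tabular consistent proper extension of one of the five would lie below another of them.

For the first fact, a logic `L` is studied through its differentiated models on total preorders, cut
out of the canonical model. If these have bounded size, `L` is tabular (`isTabular_of_bounded`).
Definable upsets are nested, and many of them give a map onto a long chain (`subset_log_chain`); so
unless `L` is below `Lup`, their number is bounded. Points of a large model then fall into few types
according to the upsets containing them, and some type has many points. Inside one type every
definable set that is met at all can be reached from every point in both directions, so that type
maps onto a large finite cluster, while everything later and everything earlier collapses to one
point each (`subset_log_of_isTrichotomy`). A formula sees only finitely many variables, so large
finite clusters do the work of an infinite one (`subset_log_of_hasTrichotomies`). Whether there are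
later and earlier points decides among the remaining four logics. -/

namespace TenseLogic

open Formula

/-! ### Truth, bounded morphisms and soundness. -/

section Semantics

variable {F : Frame} {V : ℕ → Set F.X} {φ ψ : Formula} {x : F.X}

@[simp] lemma mem_truth_var {i : ℕ} : x ∈ truth F V (var i) ↔ x ∈ V i := Iff.rfl

@[simp] lemma mem_truth_bot : x ∈ truth F V bot ↔ False := Iff.rfl

@[simp] lemma mem_truth_imp :
    x ∈ truth F V (imp φ ψ) ↔ (x ∈ truth F V φ → x ∈ truth F V ψ) := by
  simp [truth, imp_iff_not_or]

@[simp] lemma mem_truth_box : x ∈ truth F V (box φ) ↔ ∀ y, F.R x y → y ∈ truth F V φ := Iff.rfl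

@[simp] lemma mem_truth_pdia : x ∈ truth F V (pdia φ) ↔ ∃ y, F.R y x ∧ y ∈ truth F V φ := Iff.rfl

@[simp] lemma mem_truth_neg : x ∈ truth F V (neg φ) ↔ x ∉ truth F V φ := by
  simp [neg]

@[simp] lemma mem_truth_disj :
    x ∈ truth F V (disj φ ψ) ↔ x ∈ truth F V φ ∨ x ∈ truth F V ψ := by
  simp [disj, or_iff_not_imp_left]

@[simp] lemma mem_truth_conj :
    x ∈ truth F V (conj φ ψ) ↔ x ∈ truth F V φ ∧ x ∈ truth F V ψ := by
  simp [conj]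

@[simp] lemma mem_truth_dia : x ∈ truth F V (dia φ) ↔ ∃ y, F.R x y ∧ y ∈ truth F V φ := by
  simp [dia]

end Semantics

/-- A strict upper bound for the indices of the variables of a formula. -/
def varBound : Formula → ℕ
  | var i => i + 1
  | bot => 0
  | imp φ ψ => max (varBound φ) (varBound ψ)
  | box φ => varBound φ
  | pdia φ => varBound φ

/-- Bounded morphisms of tense frames. -/
structure IsPMorphism (F G : Frame) (f : F.X → G.X) : Prop where
  map : ∀ x y, F.R x y → G.R (f x) (f y)
  lift : ∀ x y, G.R (f x) y → ∃ z, F.R x z ∧ f z = y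
  colift : ∀ x y, G.R y (f x) → ∃ z, F.R z x ∧ f z = y

/-- The substitution lets a valuation on `G` pull back to one given by formulas on `F`. Agreement is
asked only of variables that can occur in `φ`, so a finite quotient need remember only finitely
many. -/
lemma IsPMorphism.mem_truth_subst {F G : Frame} {f : F.X → G.X} (hf : IsPMorphism F G f)
    {V : ℕ → Set F.X} {W : ℕ → Set G.X} {s : ℕ → Formula} (φ : Formula)
    (hs : ∀ i < varBound φ, ∀ x, x ∈ truth F V (s i) ↔ f x ∈ W i) (x : F.X) :
    x ∈ truth F V (φ.subst s) ↔ f x ∈ truth G W φ := by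
  induction φ generalizing x with
  | var i => exact hs i (Nat.lt_succ_self i) x
  | bot => exact Iff.rfl
  | imp φ ψ ihφ ihψ =>
    have h1 := ihφ (fun i hi => hs i (lt_of_lt_of_le hi (le_max_left _ _))) x
    have h2 := ihψ (fun i hi => hs i (lt_of_lt_of_le hi (le_max_right _ _))) x
    simp only [Formula.subst, mem_truth_imp, h1, h2]
  | box φ ih =>
    simp only [Formula.subst, mem_truth_box]
    constructor
    · intro h y hy
      obtain ⟨z, hz, rfl⟩ := hf.lift x y hy
      exact (ih hs z).1 (h z hz)
    · exact fun h y hy => (ih hs y).2 (h _ (hf.map _ _ hy))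
  | pdia φ ih =>
    simp only [Formula.subst, mem_truth_pdia]
    constructor
    · rintro ⟨y, hy, h⟩
      exact ⟨f y, hf.map _ _ hy, (ih hs y).1 h⟩
    · rintro ⟨y, hy, h⟩
      obtain ⟨z, hz, rfl⟩ := hf.colift x y hy
      exact ⟨z, hz, (ih hs z).2 h⟩

lemma subst_var (φ : Formula) : φ.subst var = φ := by
  induction φ <;> simp_all [Formula.subst]

lemma IsPMorphism.mem_truth {F G : Frame} {f : F.X → G.X} (hf : IsPMorphism F G f)
    {V : ℕ → Set F.X} {W : ℕ → Set G.X} (φ : Formula)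
    (hs : ∀ i < varBound φ, ∀ x, x ∈ V i ↔ f x ∈ W i) (x : F.X) :
    x ∈ truth F V φ ↔ f x ∈ truth G W φ := by
  simpa only [subst_var] using hf.mem_truth_subst (s := var) φ hs x

lemma mem_truth_subst {F : Frame} {V : ℕ → Set F.X} (s : ℕ → Formula) (φ : Formula) (x : F.X) :
    x ∈ truth F V (φ.subst s) ↔ x ∈ truth F (fun i => truth F V (s i)) φ :=
  IsPMorphism.mem_truth_subst (f := id)
    ⟨fun _ _ h => h, fun _ y h => ⟨y, h, rfl⟩, fun _ y h => ⟨y, h, rfl⟩⟩ φ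
    (fun _ _ _ => Iff.rfl) x

lemma isTenseLogic_log (F : Frame) : IsTenseLogic (Log F) where
  taut φ h V x := h (fun ψ => x ∈ truth F V ψ) (by simp) (by simp)
  adj φ ψ := by
    constructor
    · intro h V x
      have h' := fun y => h V y
      simp only [mem_truth_imp, mem_truth_pdia, mem_truth_box] at h' ⊢
      exact fun hx y hy => h' y ⟨x, hy, hx⟩
    · intro h V x
      have h' := fun y => h V y
      simp only [mem_truth_imp, mem_truth_pdia, mem_truth_box] at h' ⊢
      rintro ⟨y, hy, hyφ⟩
      exact h' y hyφ x hy
  mp φ ψ h1 h2 V x := (mem_truth_imp.1 (h2 V x)) (h1 V x)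
  subst φ h s V x := (mem_truth_subst s φ x).2 (h _ x)

lemma isTenseLogic_iInter {ι : Sort*} {L : ι → Set Formula} (h : ∀ i, IsTenseLogic (L i)) :
    IsTenseLogic (⋂ i, L i) where
  taut φ hφ := Set.mem_iInter.2 fun i => (h i).taut φ hφ
  adj φ ψ := by
    simp only [Set.mem_iInter]
    exact forall_congr' fun i => (h i).adj φ ψ
  mp φ ψ h1 h2 := by
    rw [Set.mem_iInter] at *
    exact fun i => (h i).mp φ ψ (h1 i) (h2 i)
  subst φ hφ s := by
    rw [Set.mem_iInter] at *
    exact fun i => (h i).subst φ (hφ i) s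

lemma consistent_log (F : Frame) : Consistent (Log F) :=
  fun h => F.nonempty.elim fun x => h (fun _ => ∅) x

/-! ### Linear frames and rank functions. -/

/-- Total preorders. -/
structure IsLinear (F : Frame) : Prop where
  refl : ∀ x, F.R x x
  trans : ∀ x y z, F.R x y → F.R y z → F.R x z
  total : ∀ x y, F.R x y ∨ F.R y x

lemma S43t_subset_log {F : Frame} (hF : IsLinear F) : S43t ⊆ Log F := by
  have hlog := isTenseLogic_log F
  have hKt : Kt ⊆ Log F := Set.sInter_subset_of_mem hlog
  have hS4 : S4t ⊆ Log F := by
    refine Set.sInter_subset_of_mem ⟨hlog, Set.union_subset hKt ?_⟩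
    rintro _ (rfl | rfl) V x
    · simp only [ax4, mem_truth_imp, mem_truth_box]
      exact fun h y hy z hz => h z (hF.trans _ _ _ hy hz)
    · simp only [axT, mem_truth_imp, mem_truth_box]
      exact fun h => h x (hF.refl x)
  refine Set.sInter_subset_of_mem ⟨hlog, Set.union_subset hS4 ?_⟩
  rintro _ (rfl | rfl | rfl) V x
  -- By totality every point is one step away from `x`, so `Δp` holds at `x` once `p` holds
  -- anywhere.
  · have key : ∀ y, y ∈ V 0 → x ∈ V 0 ∨ (∃ y, F.R x y ∧ y ∈ V 0) ∨ ∃ y, F.R y x ∧ y ∈ V 0 :=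
      fun y hy => Or.inr ((hF.total x y).imp (fun h => ⟨y, h, hy⟩) fun h => ⟨y, h, hy⟩)
    simp only [bz, delta, mem_truth_imp, mem_truth_disj, mem_truth_dia, mem_truth_pdia,
      mem_truth_var]
    rintro (h | ⟨y, -, h | ⟨z, -, h⟩ | ⟨z, -, h⟩⟩ | ⟨y, -, h | ⟨z, -, h⟩ | ⟨z, -, h⟩⟩)
    · exact h
    all_goals exact key _ h
  · simp only [bwForth, mem_truth_imp, mem_truth_disj, mem_truth_dia, mem_truth_conj,
      mem_truth_var]
    rintro ⟨⟨y, hy, hy0⟩, z, hz, hz1⟩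
    rcases hF.total y z with h | h
    · exact Or.inl ⟨y, hy, hy0, Or.inr ⟨z, h, hz1⟩⟩
    · exact Or.inr ⟨z, hz, hz1, Or.inr ⟨y, h, hy0⟩⟩
  · simp only [bwBack, mem_truth_imp, mem_truth_disj, mem_truth_pdia, mem_truth_conj,
      mem_truth_var]
    rintro ⟨⟨y, hy, hy0⟩, z, hz, hz1⟩
    rcases hF.total y z with h | h
    · exact Or.inr ⟨z, hz, hz1, Or.inr ⟨y, h, hy0⟩⟩
    · exact Or.inl ⟨y, hy, hy0, Or.inr ⟨z, h, hz1⟩⟩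

/-- The relation of `F` is the one induced by the rank function `r`, higher ranks coming first. -/
def IsRanked {α : Type} [LE α] (F : Frame) (r : F.X → α) : Prop := ∀ x y, F.R x y ↔ r y ≤ r x

lemma IsRanked.isLinear {α : Type} [LinearOrder α] {F : Frame} {r : F.X → α}
    (h : IsRanked F r) : IsLinear F where
  refl x := (h x x).2 le_rfl
  trans x y z hxy hyz := (h x z).2 (((h y z).1 hyz).trans ((h x y).1 hxy))
  total x y := (le_total (r y) (r x)).imp (h x y).2 (h y x).2

/-- The rank of a point of an inflated chain. -/
def inflateRank {n : ℕ} (c : Fin (n + 1)) : (inflate (chain n) c).X → Fin (n + 1) :=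
  Sum.elim (fun u : Fin (n + 1) => u) fun _ : ℕ => c

lemma isRanked_inflate {n : ℕ} (c : Fin (n + 1)) :
    IsRanked (inflate (chain n) c) (inflateRank c) := by
  rintro (u | u) (v | v)
  · simp only [inflate, chain, inflateRank, Sum.elim_inl]
    constructor
    · rintro (⟨a, b, h1, h2, h⟩ | ⟨h1, b, h2, h⟩ | ⟨⟨a, h1, h⟩, h2⟩ | ⟨h1, h2⟩) <;> simp_all
    · exact fun h => Or.inl ⟨u, v, rfl, rfl, h⟩
  · simp only [inflate, chain, inflateRank]
    simp
    rintro rfl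
    exact le_rfl
  · simp only [inflate, chain, inflateRank]
    simp
    rintro rfl
    exact le_rfl
  · simp [inflate, chain, inflateRank]

lemma isRanked_chain (n : ℕ) : IsRanked (chain n) (fun i : Fin (n + 1) => i) :=
  fun _ _ => Iff.rfl

/-- The conjunction of `f 0, …, f (n - 1)`. -/
def bigConj : ℕ → (ℕ → Formula) → Formula
  | 0, _ => neg bot
  | n + 1, f => conj (bigConj n f) (f n)

@[simp] lemma mem_truth_bigConj {F : Frame} {V : ℕ → Set F.X} {n : ℕ} {f : ℕ → Formula} {x : F.X} :
    x ∈ truth F V (bigConj n f) ↔ ∀ i < n, x ∈ truth F V (f i) := by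
  induction n with
  | zero => simp [bigConj]
  | succ n ih => simp only [bigConj, mem_truth_conj, ih, Nat.forall_lt_succ_right]

/-! ### Formulas that tell the five logics apart. -/

/-- Every point has fewer than `n` successors. -/
def fewSucc (n : ℕ) : Formula :=
  neg (bigConj n fun i => dia (conj (var i) (bigConj i fun j => neg (var j))))

lemma fewSucc_mem_log_of_finite {F : Frame} [Finite F.X] {n : ℕ} (h : Nat.card F.X < n) :
    fewSucc n ∈ Log F := by
  intro V x
  simp only [fewSucc, mem_truth_neg, mem_truth_bigConj, mem_truth_dia, mem_truth_conj,
    mem_truth_var]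
  intro hx
  have := F.nonempty
  choose! y hxy hy hlt using hx
  have hinj : Function.Injective (fun i : Fin n => y i) := by
    intro i j hij
    by_contra hne
    simp only at hij
    rcases lt_or_gt_of_ne hne with hl | hl
    · exact hlt j j.2 i hl (hij ▸ hy i i.2)
    · exact hlt i i.2 j hl (hij ▸ hy j j.2)
  have := Nat.card_le_card_of_injective _ hinj
  simp only [Nat.card_eq_fintype_card, Fintype.card_fin] at this
  omega

lemma fewSucc_notMem_log {F : Frame} {n : ℕ} {x : F.X} (e : Fin n → F.X)
    (he : Function.Injective e) (hx : ∀ i, F.R x (e i)) : fewSucc n ∉ Log F := by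
  intro h
  -- Each variable below `n` names one point of the list; the others are false everywhere.
  have hV := h (fun i => {y | ∃ hi : i < n, e ⟨i, hi⟩ = y}) x
  simp only [fewSucc, mem_truth_neg, mem_truth_bigConj, mem_truth_dia, mem_truth_conj,
    mem_truth_var, not_forall] at hV
  obtain ⟨i, hi, hV⟩ := hV
  refine hV ⟨e ⟨i, hi⟩, hx _, ⟨hi, rfl⟩, ?_⟩
  rintro j hj ⟨hj', hij⟩
  have := he hij
  simp only [Fin.mk.injEq] at this
  omega

lemma not_isTabular_of_fewSucc {L : Set Formula} (h : ∀ n, fewSucc n ∉ L) : ¬ IsTabular L := by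
  rintro ⟨F, hF, rfl⟩
  exact h _ (fewSucc_mem_log_of_finite (Nat.lt_succ_self _))

lemma fewSucc_notMem_log_inflate {n : ℕ} (c : Fin (n + 1)) (k : ℕ) :
    fewSucc k ∉ Log (inflate (chain n) c) :=
  fewSucc_notMem_log (x := Sum.inr 0) (fun i : Fin k => Sum.inr (i : ℕ))
    (fun _ _ h => Fin.ext (Sum.inr_injective h))
    (fun _ => (isRanked_inflate c _ _).2 le_rfl)

lemma fewSucc_notMem_Lup (n : ℕ) : fewSucc n ∉ Lup := by
  intro h
  exact fewSucc_notMem_log (x := Fin.last n) (F := chain n) Fin.castSucc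
    (Fin.castSucc_injective n) (fun _ => Fin.le_last _) (Set.mem_iInter.1 h n)

/-- Bounded depth: along the relation there are at most `k` clusters. -/
def depthLE : ℕ → ℕ → Formula
  | 0, _ => bot
  | k + 1, i => imp (var i) (box (disj (dia (var i)) (depthLE k (i + 1))))

lemma mem_truth_depthLE {F : Frame} {r : F.X → ℕ} (hr : IsRanked F r) {V : ℕ → Set F.X} (k i : ℕ)
    (x : F.X) (hx : r x < k) : x ∈ truth F V (depthLE k i) := by
  induction k generalizing i x with
  | zero => omega
  | succ k ih =>
    simp only [depthLE, mem_truth_imp, mem_truth_box, mem_truth_disj, mem_truth_dia, mem_truth_var]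
    intro hi y hy
    rcases le_or_gt (r x) (r y) with h | h
    · exact Or.inl ⟨x, (hr _ _).2 h, hi⟩
    · exact Or.inr (ih _ _ (by omega))

lemma depthLE_mem_log {F : Frame} {r : F.X → ℕ} (hr : IsRanked F r) {k : ℕ} (h : ∀ x, r x < k) :
    depthLE k 0 ∈ Log F := fun _ x => mem_truth_depthLE hr k 0 x (h x)

lemma depthLE_notMem_log {F : Frame} {r : F.X → ℕ} (hr : IsRanked F r) {k : ℕ} (e : ℕ → F.X)
    (he : ∀ j ≤ k, r (e j) = j) : depthLE k 0 ∉ Log F := by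
  intro h
  -- Variable `i` marks rank `k - i`, so the nested variables are met in order along the descent `e
  -- k, …, e 0`.
  have key : ∀ j ≤ k, e j ∉ truth F (fun i => {x | r x + i = k}) (depthLE j (k - j)) := by
    intro j hj
    induction j with
    | zero => simp [depthLE]
    | succ j ih =>
      have hj' := he j (by omega)
      simp only [depthLE, mem_truth_imp, mem_truth_box, mem_truth_disj, mem_truth_dia,
        mem_truth_var]
      intro H
      rcases H (show r (e (j + 1)) + (k - (j + 1)) = k by rw [he _ hj]; omega) (e j)
        ((hr _ _).2 (by rw [he _ hj, hj']; omega)) with ⟨z, hz, hz'⟩ | H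
      · have h1 := (hr _ _).1 hz
        have h2 : r z + (k - (j + 1)) = k := hz'
        omega
      · rw [show k - (j + 1) + 1 = k - j by omega] at H
        exact ih (by omega) H
  exact key k le_rfl (by simpa using h _ (e k))

/-- `□◇p → ◇□p` -/
def mcKinsey : Formula := imp (box (dia (var 0))) (dia (box (var 0)))

/-- The converse of `mcKinsey`, about the relation in the past. -/
def mcKinseyPast : Formula :=
  imp (neg (pdia (neg (pdia (var 0))))) (pdia (neg (pdia (neg (var 0)))))

/-- At a last point seeing only itself, `◇p` and `□p` coincide. -/
lemma mcKinsey_mem_log {F : Frame} (t : F.X) (ht : ∀ x, F.R x t) (h : ∀ y, F.R t y → y = t) :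
    mcKinsey ∈ Log F := by
  intro V x
  simp only [mcKinsey, mem_truth_imp, mem_truth_box, mem_truth_dia, mem_truth_var]
  intro hx
  obtain ⟨y, hy, hy0⟩ := hx t (ht x)
  refine ⟨t, ht x, fun z hz => ?_⟩
  rw [h z hz, ← h y hy]
  exact hy0

/-- Make `p` true at `a` only: `a` is always ahead, but so is `b`. -/
lemma mcKinsey_notMem_log {F : Frame} {a b : F.X} (hab : a ≠ b) (ha : ∀ x, F.R x a)
    (hb : ∀ x, F.R x b) : mcKinsey ∉ Log F := by
  intro h
  have hV := h (fun _ => {a}) a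
  simp only [mcKinsey, mem_truth_imp, mem_truth_box, mem_truth_dia, mem_truth_var] at hV
  obtain ⟨y, -, hy⟩ := hV fun y _ => ⟨a, ha y, rfl⟩
  exact hab (hy b (hb y)).symm

lemma mcKinseyPast_mem_log {F : Frame} (t : F.X) (ht : ∀ x, F.R t x)
    (h : ∀ y, F.R y t → y = t) : mcKinseyPast ∈ Log F := by
  intro V x
  simp only [mcKinseyPast, mem_truth_imp, mem_truth_neg, mem_truth_pdia, mem_truth_var, not_exists,
    not_and, not_not]
  intro hx
  obtain ⟨y, hy, hy0⟩ : ∃ y, F.R y t ∧ y ∈ V 0 := by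
    by_contra hc
    exact hx t (ht x) fun y hy hy0 => hc ⟨y, hy, hy0⟩
  refine ⟨t, ht x, fun z hz => ?_⟩
  rw [h z hz, ← h y hy]
  exact hy0

lemma mcKinseyPast_notMem_log {F : Frame} {a b : F.X} (hab : a ≠ b) (ha : ∀ x, F.R a x)
    (hb : ∀ x, F.R b x) : mcKinseyPast ∉ Log F := by
  intro h
  have hV := h (fun _ => {a}) a
  simp only [mcKinseyPast, mem_truth_imp, mem_truth_neg, mem_truth_pdia, mem_truth_var, not_exists,
    not_and, not_not] at hV
  obtain ⟨y, -, hy⟩ := hV fun y _ hy => hy a (ha y) rfl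
  exact hab (hy b (hb y)).symm

/-- `□(□(p → □p) → p) → p` -/
def grz : Formula :=
  imp (box (imp (box (imp (var 0) (box (var 0)))) (var 0))) (var 0)

lemma grz_mem_log {F : Frame} {r : F.X → ℕ} (hr : IsRanked F r) (hinj : Function.Injective r) :
    grz ∈ Log F := by
  intro V x
  simp only [grz, mem_truth_imp, mem_truth_box, mem_truth_var]
  induction h : r x using Nat.strong_induction_on generalizing x with
  | h k ih =>
    subst h
    have hlin := hr.isLinear
    intro hx
    refine hx x (hlin.refl x) fun y hy hy0 z hz => ?_
    -- A point of lower rank is covered by induction; otherwise all three ranks agree, and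
    -- injectivity gives `z = y`.
    rcases ((hr _ _).1 (hlin.trans _ _ _ hy hz)).lt_or_eq with h | h
    · exact ih _ h z rfl fun w hw => hx w (hlin.trans _ _ _ (hlin.trans _ _ _ hy hz) hw)
    · have h1 := (hr _ _).1 hy
      have h2 := (hr _ _).1 hz
      rwa [hinj (show r z = r y by omega)]

/-- Make `p` false at `a` only. Then `p → □p` fails at `b`, so the inner antecedent fails at `a`,
the one place where `p` does. -/
lemma grz_notMem_log {F : Frame} {a b : F.X} (hne : a ≠ b) (hab : F.R a b) (hba : F.R b a)
    (haa : F.R a a) : grz ∉ Log F := by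
  intro h
  have hV := h (fun _ => {a}ᶜ) a
  simp only [grz, mem_truth_imp, mem_truth_box, mem_truth_var] at hV
  refine hV (fun y _ hy => ?_) rfl
  rintro rfl
  exact hy b hab hne.symm y hba rfl

lemma grz_mem_Lup : grz ∈ Lup :=
  Set.mem_iInter.2 fun n => grz_mem_log (r := fun i : Fin (n + 1) => (i : ℕ))
    (fun _ _ => Fin.le_def) Fin.val_injective

lemma isRanked_inflate_val {n : ℕ} (c : Fin (n + 1)) :
    IsRanked (inflate (chain n) c) (fun x => (inflateRank c x : ℕ)) :=
  fun x y => (isRanked_inflate c x y).trans Fin.le_def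

lemma grz_notMem_log_inflate {n : ℕ} (c : Fin (n + 1)) : grz ∉ Log (inflate (chain n) c) :=
  grz_notMem_log (a := Sum.inr 0) (b := Sum.inr 1)
    (fun h => Nat.zero_ne_one (Sum.inr_injective h))
    ((isRanked_inflate c _ _).2 le_rfl) ((isRanked_inflate c _ _).2 le_rfl)
    ((isRanked_inflate c _ _).2 le_rfl)

lemma depthLE_mem_log_inflate {n : ℕ} (c : Fin (n + 1)) :
    depthLE (n + 1) 0 ∈ Log (inflate (chain n) c) :=
  depthLE_mem_log (isRanked_inflate_val c) fun x => (inflateRank c x).2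

lemma depthLE_notMem_log_chain (n : ℕ) : depthLE n 0 ∉ Log (chain n) :=
  depthLE_notMem_log (r := fun i : Fin (n + 1) => (i : ℕ))
    (fun _ _ => Fin.le_def) (fun j => Fin.ofNat (n + 1) j)
    fun _ hj => Nat.mod_eq_of_lt (Nat.lt_succ_of_le hj)

lemma depthLE_notMem_Lup (n : ℕ) : depthLE n 0 ∉ Lup :=
  fun h => depthLE_notMem_log_chain n (Set.mem_iInter.1 h n)

lemma depthLE_notMem_log_inflate {n : ℕ} (c : Fin (n + 1)) :
    depthLE n 0 ∉ Log (inflate (chain n) c) :=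
  depthLE_notMem_log (isRanked_inflate_val c) (fun j => Sum.inl (Fin.ofNat (n + 1) j))
    fun _ hj => Nat.mod_eq_of_lt (Nat.lt_succ_of_le hj)

lemma mcKinsey_mem_log_inflate {n : ℕ} {c : Fin (n + 1)} (hc : 0 < c) :
    mcKinsey ∈ Log (inflate (chain n) c) := by
  refine mcKinsey_mem_log (Sum.inl (0 : Fin (n + 1)))
    (fun x => (isRanked_inflate c _ _).2 (Fin.zero_le _)) ?_
  rintro (y | y) hy <;> have h := (isRanked_inflate c _ _).1 hy
  · exact congrArg Sum.inl (le_antisymm (α := Fin (n + 1)) h (Fin.zero_le y))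
  · exact absurd h (not_le_of_gt hc)

lemma mcKinsey_notMem_log_inflate (n : ℕ) : mcKinsey ∉ Log (inflate (chain n) (0 : Fin (n + 1))) :=
  mcKinsey_notMem_log (a := Sum.inr 0) (b := Sum.inr 1)
    (fun h => Nat.zero_ne_one (Sum.inr_injective h))
    (fun _ => (isRanked_inflate _ _ _).2 (Fin.zero_le _))
    (fun _ => (isRanked_inflate _ _ _).2 (Fin.zero_le _))

lemma mcKinseyPast_mem_log_inflate {n : ℕ} {c : Fin (n + 1)} (hc : c < Fin.last n) :
    mcKinseyPast ∈ Log (inflate (chain n) c) := by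
  refine mcKinseyPast_mem_log (Sum.inl (Fin.last n))
    (fun x => (isRanked_inflate c _ _).2 (Fin.le_last _)) ?_
  rintro (y | y) hy <;> have h := (isRanked_inflate c _ _).1 hy
  · exact congrArg Sum.inl (le_antisymm (α := Fin (n + 1)) (Fin.le_last y) h)
  · exact absurd h (not_le_of_gt hc)

lemma mcKinseyPast_notMem_log_inflate (n : ℕ) :
    mcKinseyPast ∉ Log (inflate (chain n) (Fin.last n)) :=
  mcKinseyPast_notMem_log (a := Sum.inr 0) (b := Sum.inr 1)
    (fun h => Nat.zero_ne_one (Sum.inr_injective h))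
    (fun _ => (isRanked_inflate _ _ _).2 (Fin.le_last _))
    (fun _ => (isRanked_inflate _ _ _).2 (Fin.le_last _))

/-! ### The five logics: incomparability and non-tabularity. -/

/-- The five logics of the classification. -/
def fiveLogics : Fin 5 → Set Formula := ![Lpm, Lplus, Lminus, Lcirc, Lup]

lemma depthLE_two_mem_Lplus : depthLE 2 0 ∈ Lplus := depthLE_mem_log_inflate (n := 1) 1

lemma depthLE_two_mem_Lminus : depthLE 2 0 ∈ Lminus := depthLE_mem_log_inflate (n := 1) 0

lemma depthLE_two_notMem_Lpm : depthLE 2 0 ∉ Lpm := depthLE_notMem_log_inflate (n := 2) 1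

lemma depthLE_one_notMem : ∀ i, i ≠ 3 → depthLE 1 0 ∉ fiveLogics i := by
  intro i hi
  fin_cases i
  · exact depthLE_notMem_log (isRanked_inflate_val (n := 2) 1)
      (fun j => Sum.inl (Fin.ofNat 3 j)) fun j hj => Nat.mod_eq_of_lt (by omega)
  · exact depthLE_notMem_log_inflate (n := 1) 1
  · exact depthLE_notMem_log_inflate (n := 1) 0
  · exact absurd rfl hi
  · exact depthLE_notMem_Lup 1

lemma mcKinsey_mem_Lpm : mcKinsey ∈ Lpm := mcKinsey_mem_log_inflate (n := 2) (c := 1) (by decide)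

lemma mcKinsey_mem_Lplus : mcKinsey ∈ Lplus :=
  mcKinsey_mem_log_inflate (n := 1) (c := 1) (by decide)

lemma mcKinsey_notMem_Lminus : mcKinsey ∉ Lminus := mcKinsey_notMem_log_inflate 1

lemma mcKinsey_notMem_Lcirc : mcKinsey ∉ Lcirc := mcKinsey_notMem_log_inflate 0

lemma mcKinseyPast_mem_Lpm : mcKinseyPast ∈ Lpm :=
  mcKinseyPast_mem_log_inflate (n := 2) (c := 1) (by decide)

lemma mcKinseyPast_mem_Lminus : mcKinseyPast ∈ Lminus :=
  mcKinseyPast_mem_log_inflate (n := 1) (c := 0) (by decide)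

lemma mcKinseyPast_notMem_Lplus : mcKinseyPast ∉ Lplus := mcKinseyPast_notMem_log_inflate 1

lemma mcKinseyPast_notMem_Lcirc : mcKinseyPast ∉ Lcirc := mcKinseyPast_notMem_log_inflate 0

lemma grz_notMem : ∀ i, i ≠ 4 → grz ∉ fiveLogics i := by
  intro i hi
  fin_cases i
  · exact grz_notMem_log_inflate (n := 2) 1
  · exact grz_notMem_log_inflate (n := 1) 1
  · exact grz_notMem_log_inflate (n := 1) 0
  · exact grz_notMem_log_inflate (n := 0) 0
  · exact absurd rfl hi

/-- Depth counts clusters, the McKinsey formulas detect a single last or first point, and `grz`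
excludes proper clusters. Only `Lcirc` has depth one, and only `Lup` contains `grz`. -/
lemma eq_of_fiveLogics_subset {i j : Fin 5} (h : fiveLogics i ⊆ fiveLogics j) : i = j := by
  by_contra hne
  fin_cases i
  · fin_cases j
    · exact hne rfl
    · exact mcKinseyPast_notMem_Lplus (h mcKinseyPast_mem_Lpm)
    · exact mcKinsey_notMem_Lminus (h mcKinsey_mem_Lpm)
    · exact mcKinsey_notMem_Lcirc (h mcKinsey_mem_Lpm)
    · exact depthLE_notMem_Lup 3 (h (depthLE_mem_log_inflate (n := 2) 1))
  · fin_cases j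
    · exact depthLE_two_notMem_Lpm (h depthLE_two_mem_Lplus)
    · exact hne rfl
    · exact mcKinsey_notMem_Lminus (h mcKinsey_mem_Lplus)
    · exact mcKinsey_notMem_Lcirc (h mcKinsey_mem_Lplus)
    · exact depthLE_notMem_Lup 2 (h depthLE_two_mem_Lplus)
  · fin_cases j
    · exact depthLE_two_notMem_Lpm (h depthLE_two_mem_Lminus)
    · exact mcKinseyPast_notMem_Lplus (h mcKinseyPast_mem_Lminus)
    · exact hne rfl
    · exact mcKinseyPast_notMem_Lcirc (h mcKinseyPast_mem_Lminus)
    · exact depthLE_notMem_Lup 2 (h depthLE_two_mem_Lminus)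
  · exact depthLE_one_notMem j (Ne.symm hne) (h (depthLE_mem_log_inflate (n := 0) 0))
  · exact grz_notMem j (Ne.symm hne) (h grz_mem_Lup)

lemma isTenseLogic_fiveLogics (i : Fin 5) : IsTenseLogic (fiveLogics i) := by
  fin_cases i
  iterate 4 exact isTenseLogic_log _
  exact isTenseLogic_iInter fun n => isTenseLogic_log (chain n)

lemma S43t_subset_fiveLogics (i : Fin 5) : S43t ⊆ fiveLogics i := by
  fin_cases i
  iterate 4 exact S43t_subset_log (isRanked_inflate _).isLinear
  exact Set.subset_iInter fun n => S43t_subset_log (isRanked_chain n).isLinear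

lemma consistent_fiveLogics (i : Fin 5) : Consistent (fiveLogics i) := by
  fin_cases i
  iterate 4 exact consistent_log _
  exact fun h => consistent_log (chain 0) (Set.mem_iInter.1 h 0)

lemma not_isTabular_fiveLogics (i : Fin 5) : ¬ IsTabular (fiveLogics i) := by
  refine not_isTabular_of_fewSucc fun n => ?_
  fin_cases i
  iterate 4 exact fewSucc_notMem_log_inflate _ n
  exact fewSucc_notMem_Lup n

/-! ### Normality derived from the adjunction. -/

section Derivations

variable {L : Set Formula} {φ ψ χ : Formula}

lemma IsTenseLogic.imp_trans (hL : IsTenseLogic L) (h1 : imp φ ψ ∈ L) (h2 : imp ψ χ ∈ L) :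
    imp φ χ ∈ L := by
  have h : imp (imp φ ψ) (imp (imp ψ χ) (imp φ χ)) ∈ L :=
    hL.taut _ fun v _ hi => by simp only [hi]; tauto
  exact hL.mp _ _ h2 (hL.mp _ _ h1 h)

lemma IsTenseLogic.imp_self (hL : IsTenseLogic L) (φ : Formula) : imp φ φ ∈ L :=
  hL.taut _ fun v _ hi => by simp only [hi]; tauto

lemma IsTenseLogic.imp_of_mem (hL : IsTenseLogic L) (h : ψ ∈ L) : imp φ ψ ∈ L :=
  hL.mp _ _ h (hL.taut _ fun v _ hi => by simp only [hi]; tauto)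

lemma IsTenseLogic.imp_conj (hL : IsTenseLogic L) (h1 : imp φ ψ ∈ L) (h2 : imp φ χ ∈ L) :
    imp φ (conj ψ χ) ∈ L := by
  have h : imp (imp φ ψ) (imp (imp φ χ) (imp φ (conj ψ χ))) ∈ L :=
    hL.taut _ fun v _ hi => by simp only [conj, neg, hi]; tauto
  exact hL.mp _ _ h2 (hL.mp _ _ h1 h)

lemma IsTenseLogic.disj_imp (hL : IsTenseLogic L) (h1 : imp φ χ ∈ L) (h2 : imp ψ χ ∈ L) :
    imp (disj φ ψ) χ ∈ L := by
  have h : imp (imp φ χ) (imp (imp ψ χ) (imp (disj φ ψ) χ)) ∈ L :=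
    hL.taut _ fun v _ hi => by simp only [disj, neg, hi]; tauto
  exact hL.mp _ _ h2 (hL.mp _ _ h1 h)

lemma IsTenseLogic.imp_box_pdia (hL : IsTenseLogic L) (φ : Formula) :
    imp φ (box (pdia φ)) ∈ L := (hL.adj _ _).1 (hL.imp_self _)

lemma IsTenseLogic.pdia_box_imp (hL : IsTenseLogic L) (φ : Formula) :
    imp (pdia (box φ)) φ ∈ L := (hL.adj _ _).2 (hL.imp_self _)

lemma IsTenseLogic.pdia_mono (hL : IsTenseLogic L) (h : imp φ ψ ∈ L) :
    imp (pdia φ) (pdia ψ) ∈ L := (hL.adj _ _).2 (hL.imp_trans h (hL.imp_box_pdia ψ))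

lemma IsTenseLogic.box_mono (hL : IsTenseLogic L) (h : imp φ ψ ∈ L) :
    imp (box φ) (box ψ) ∈ L := (hL.adj _ _).1 (hL.imp_trans (hL.pdia_box_imp φ) h)

/-- Necessitation is not postulated: it is the adjoint form of `⧫⊤ → φ`. -/
lemma IsTenseLogic.box_mem (hL : IsTenseLogic L) (h : φ ∈ L) : box φ ∈ L :=
  hL.mp _ _ (hL.imp_self bot) ((hL.adj _ _).1 (hL.imp_of_mem h))

/-- Right adjoints preserve meets; `pdia_disj` is the dual. -/
lemma IsTenseLogic.box_conj (hL : IsTenseLogic L) (φ ψ : Formula) :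
    imp (conj (box φ) (box ψ)) (box (conj φ ψ)) ∈ L := by
  refine (hL.adj _ _).1 (hL.imp_conj ?_ ?_)
  · exact hL.imp_trans (hL.pdia_mono (hL.taut _ fun v hb hi => by
      simp only [conj, neg, hi]; tauto)) (hL.pdia_box_imp φ)
  · exact hL.imp_trans (hL.pdia_mono (hL.taut _ fun v hb hi => by
      simp only [conj, neg, hi]; tauto)) (hL.pdia_box_imp ψ)

lemma IsTenseLogic.pdia_disj (hL : IsTenseLogic L) (φ ψ : Formula) :
    imp (pdia (disj φ ψ)) (disj (pdia φ) (pdia ψ)) ∈ L := by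
  refine (hL.adj _ _).2 (hL.disj_imp ?_ ?_)
  · exact (hL.adj _ _).1 (hL.taut _ fun v hb hi => by simp only [disj, neg, hi]; tauto)
  · exact (hL.adj _ _).1 (hL.taut _ fun v hb hi => by simp only [disj, neg, hi]; tauto)

end Derivations

/-! ### Maximal consistent sets and the canonical model. -/

/-- Sets of formulas that contain `L` and are closed under modus ponens. -/
structure IsTheory (L T : Set Formula) : Prop where
  subset : L ⊆ T
  mp : ∀ φ ψ, φ ∈ T → imp φ ψ ∈ T → ψ ∈ T

/-- Maximal `L`-consistent sets. -/
structure IsMaxConsistent (L w : Set Formula) : Prop where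
  subset : L ⊆ w
  bot_notMem : bot ∉ w
  imp_iff : ∀ φ ψ, imp φ ψ ∈ w ↔ (φ ∈ w → ψ ∈ w)

lemma exists_isMaxConsistent {L T : Set Formula} (hL : IsTenseLogic L) (hT : IsTheory L T)
    (hbot : bot ∉ T) : ∃ w, T ⊆ w ∧ IsMaxConsistent L w := by
  obtain ⟨w, hTw, hw⟩ := zorn_subset_nonempty {T | IsTheory L T ∧ bot ∉ T} (by
    intro c hc hchain ⟨T₀, hT₀⟩
    refine ⟨⋃₀ c, ⟨⟨fun φ hφ => ⟨T₀, hT₀, (hc hT₀).1.subset hφ⟩, ?_⟩, ?_⟩,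
      fun s hs => Set.subset_sUnion_of_mem hs⟩
    · rintro φ ψ ⟨s, hs, hφ⟩ ⟨t, ht, hψ⟩
      rcases hchain.total hs ht with h | h
      · exact ⟨t, ht, (hc ht).1.mp _ _ (h hφ) hψ⟩
      · exact ⟨s, hs, (hc hs).1.mp _ _ hφ (h hψ)⟩
    · rintro ⟨s, hs, h⟩
      exact (hc hs).2 h) T ⟨hT, hbot⟩
  obtain ⟨hwT, hwbot⟩ := hw.prop
  have htaut : ∀ φ, IsTautology φ → φ ∈ w := fun φ h => hwT.subset (hL.taut φ h)
  have hneg : ∀ φ, φ ∉ w → imp φ bot ∈ w := by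
    intro φ hφ
    by_contra hc
    -- This is the theory generated by `w` and `φ`; by maximality of `w` it must be inconsistent.
    have hext : {ψ | imp φ ψ ∈ w} ∈ {T | IsTheory L T ∧ bot ∉ T} := by
      refine ⟨⟨fun ψ hψ => hwT.subset (hL.imp_of_mem hψ), fun ψ χ h1 h2 => ?_⟩, hc⟩
      exact hwT.mp _ _ h1 (hwT.mp _ _ h2 (htaut _ fun v _ hi => by simp only [hi]; tauto))
    refine hφ (hw.le_of_ge hext (fun ψ hψ => ?_) (hwT.subset (hL.imp_self φ)))
    exact hwT.mp _ _ hψ (htaut _ fun v _ hi => by simp only [hi]; tauto)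
  refine ⟨w, hTw, hwT.subset, hwbot, fun φ ψ => ⟨fun h hφ => hwT.mp _ _ hφ h, fun h => ?_⟩⟩
  by_cases hφ : φ ∈ w
  · exact hwT.mp _ _ (h hφ) (htaut _ fun v _ hi => by simp only [hi]; tauto)
  · exact hwT.mp _ _ (hneg φ hφ) (htaut _ fun v hb hi => by simp only [hi]; tauto)

namespace IsMaxConsistent

variable {L w : Set Formula} {φ ψ : Formula}

lemma mp (hw : IsMaxConsistent L w) (h : imp φ ψ ∈ L) (hφ : φ ∈ w) : ψ ∈ w :=
  (hw.imp_iff _ _).1 (hw.subset h) hφ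

lemma neg_iff (hw : IsMaxConsistent L w) : neg φ ∈ w ↔ φ ∉ w :=
  (hw.imp_iff _ _).trans ⟨fun h hφ => hw.bot_notMem (h hφ), fun h hφ => absurd hφ h⟩

lemma conj_iff (hw : IsMaxConsistent L w) : conj φ ψ ∈ w ↔ φ ∈ w ∧ ψ ∈ w := by
  rw [conj, hw.neg_iff, hw.imp_iff, hw.neg_iff]
  tauto

lemma disj_iff (hw : IsMaxConsistent L w) : disj φ ψ ∈ w ↔ φ ∈ w ∨ ψ ∈ w := by
  rw [disj, hw.imp_iff, hw.neg_iff]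
  tauto

lemma exists_box (hL : IsTenseLogic L) (hw : IsMaxConsistent L w) (h : box φ ∉ w) :
    ∃ v, IsMaxConsistent L v ∧ (∀ ψ, box ψ ∈ w → ψ ∈ v) ∧ φ ∉ v := by
  have hT : IsTheory L {ψ | box (imp (neg φ) ψ) ∈ w} := by
    refine ⟨fun ψ hψ => hw.subset (hL.box_mem (hL.imp_of_mem hψ)), fun ψ χ h1 h2 => ?_⟩
    refine hw.mp (hL.box_mono ?_) (hw.mp (hL.box_conj _ _) (hw.conj_iff.2 ⟨h1, h2⟩))
    exact hL.taut _ fun v hb hi => by simp only [conj, neg, hi]; tauto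
  obtain ⟨v, hTv, hv⟩ := exists_isMaxConsistent hL hT fun hc => h <|
    hw.mp (hL.box_mono (hL.taut _ fun v hb hi => by simp only [neg, hi]; tauto)) hc
  refine ⟨v, hv, fun ψ hψ => hTv ?_, hv.neg_iff.1 (hTv ?_)⟩
  · exact hw.mp (hL.box_mono (hL.taut _ fun v hb hi => by simp only [hi]; tauto)) hψ
  · exact hw.subset (hL.box_mem (hL.imp_self _))

lemma exists_pdia (hL : IsTenseLogic L) (hw : IsMaxConsistent L w) (h : pdia φ ∈ w) :
    ∃ v, IsMaxConsistent L v ∧ (∀ ψ, box ψ ∈ v → ψ ∈ w) ∧ φ ∈ v := by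
  -- The condition says that `φ → ψ` is necessary in the past, the past box being `¬⧫¬`.
  have hT : IsTheory L {ψ | pdia (neg (imp φ ψ)) ∉ w} := by
    refine ⟨fun ψ hψ hc => ?_, fun ψ χ h1 h2 hc => ?_⟩
    · refine hw.bot_notMem (hw.mp ((hL.adj _ _).2 (hL.mp _ _ (hL.imp_of_mem (φ := φ) hψ) ?_)) hc)
      exact hL.taut _ fun v hb hi => by simp only [neg, hi]; tauto
    · have h3 : imp (neg (imp φ χ)) (disj (neg (imp φ ψ)) (neg (imp φ (imp ψ χ)))) ∈ L :=
        hL.taut _ fun v hb hi => by simp only [disj, neg, hi]; tauto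
      exact (hw.disj_iff.1 (hw.mp (hL.pdia_disj _ _) (hw.mp (hL.pdia_mono h3) hc))).elim h1 h2
  obtain ⟨v, hTv, hv⟩ := exists_isMaxConsistent hL hT fun hc => hc <|
    hw.mp (hL.pdia_mono (hL.taut _ fun v hb hi => by simp only [neg, hi]; tauto)) h
  refine ⟨v, hv, fun ψ hψ => ?_, hTv fun hc => ?_⟩
  · by_contra hψw
    refine hv.neg_iff.1 (hTv (a := neg (box ψ)) fun hc => hψw ?_) hψ
    refine hw.mp (hL.pdia_box_imp ψ) (hw.mp (hL.pdia_mono ?_) hc)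
    exact hL.taut _ fun v hb hi => by simp only [neg, hi]; tauto
  · refine hw.bot_notMem (hw.mp ((hL.adj _ _).2 ?_) hc)
    exact hL.taut _ fun v hb hi => by simp only [neg, hi]; tauto

end IsMaxConsistent

/-- The canonical frame of a logic. -/
abbrev canonicalFrame (L : Set Formula) (h : Nonempty {w // IsMaxConsistent L w}) : Frame where
  X := {w // IsMaxConsistent L w}
  nonempty := h
  R w v := ∀ φ, box φ ∈ w.1 → φ ∈ v.1

/-- The relation is defined from `□` alone; `φ → □⧫φ` makes it sound for `⧫`, and `exists_pdia`
supplies the predecessors. -/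
lemma mem_truth_canonical {L : Set Formula} (hL : IsTenseLogic L)
    (h : Nonempty {w // IsMaxConsistent L w}) (φ : Formula) (w : {w // IsMaxConsistent L w}) :
    w ∈ truth (canonicalFrame L h) (fun i => {w | var i ∈ w.1}) φ ↔ φ ∈ w.1 := by
  induction φ generalizing w with
  | var i => exact Iff.rfl
  | bot => exact ⟨False.elim, fun hw => w.2.bot_notMem hw⟩
  | imp φ ψ ihφ ihψ => exact mem_truth_imp.trans (by rw [ihφ, ihψ, w.2.imp_iff])
  | box φ ih =>
    constructor
    · intro hw
      by_contra hc
      obtain ⟨v, hv, hR, hφ⟩ := w.2.exists_box hL hc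
      exact hφ ((ih ⟨v, hv⟩).1 (hw ⟨v, hv⟩ hR))
    · exact fun hw v hv => (ih v).2 (hv φ hw)
  | pdia φ ih =>
    constructor
    · rintro ⟨v, hv, hφ⟩
      exact hv _ (v.2.mp (hL.imp_box_pdia φ) ((ih v).1 hφ))
    · intro hw
      obtain ⟨v, hv, hR, hφ⟩ := w.2.exists_pdia hL hw
      exact ⟨⟨v, hv⟩, hR, (ih ⟨v, hv⟩).2 hφ⟩

/-! ### Differentiated linear models and definable sets. -/

/-- Differentiated models on total preorders in which all theorems of `L` are true. -/
structure IsLinearModel (L : Set Formula) (F : Frame) (V : ℕ → Set F.X) : Prop where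
  linear : IsLinear F
  differentiated : ∀ x y, (∀ φ, x ∈ truth F V φ → y ∈ truth F V φ) → x = y
  valid : ∀ φ ∈ L, ∀ x, x ∈ truth F V φ

lemma S43t_axioms : axT ∈ S43t ∧ ax4 ∈ S43t ∧ bz 1 ∈ S43t := by
  have h : S4t ⊆ S43t := Set.subset_sInter fun L hL => Set.subset_union_left.trans hL.2
  exact ⟨h fun L hL => hL.2 (by simp), h fun L hL => hL.2 (by simp), fun L hL => hL.2 (by simp)⟩

lemma exists_isLinearModel_of_notMem {L : Set Formula} (hL : IsTenseLogic L) (hS : S43t ⊆ L)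
    {φ : Formula} (hφ : φ ∉ L) :
    ∃ F V, IsLinearModel L F V ∧ ∃ x, x ∉ truth F V φ := by
  obtain ⟨w₀, hw₀, hw₀max⟩ := exists_isMaxConsistent (T := {ψ | imp (neg φ) ψ ∈ L}) hL
    ⟨fun ψ hψ => hL.imp_of_mem hψ, fun ψ χ h1 h2 => hL.mp _ _ (hL.imp_conj h1 h2) (hL.taut _
      fun v hb hi => by simp only [conj, neg, hi]; tauto)⟩
    (fun h => hφ (hL.mp _ _ h (hL.taut _ fun v hb hi => by simp only [neg, hi]; tauto)))
  have hφw : φ ∉ w₀ := hw₀max.neg_iff.1 (hw₀ (hL.imp_self _))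
  have hne : Nonempty {w // IsMaxConsistent L w} := ⟨⟨w₀, hw₀max⟩⟩
  set C := canonicalFrame L hne
  set V : ℕ → Set C.X := fun i => {w | var i ∈ w.1}
  have htruth : ∀ (ψ : Formula) (w : C.X), w ∈ truth C V ψ ↔ ψ ∈ w.1 :=
    mem_truth_canonical hL hne
  have hvalid : ∀ ψ ∈ S43t, ∀ s (w : C.X), w ∈ truth C V (ψ.subst s) := fun ψ hψ s w =>
    (htruth _ _).2 (w.2.subset (hL.subst _ (hS hψ) s))
  have hrefl : ∀ w, C.R w w := fun w ψ hψ =>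
    (w.2.imp_iff _ _).1 ((htruth _ _).1 (hvalid _ S43t_axioms.1 (fun _ => ψ) w)) hψ
  have htrans : ∀ w v u, C.R w v → C.R v u → C.R w u := fun w v u hwv hvu ψ hψ =>
    hvu _ (hwv _ ((w.2.imp_iff _ _).1
      ((htruth _ _).1 (hvalid _ S43t_axioms.2.1 (fun _ => ψ) w)) hψ))
  -- If `w` and `v` were incomparable, some `¬α ∧ □β` would hold at `v`, two steps from `w`. By `bz
  -- 1` it holds within one step of `w`, yet `□α ∈ w` bars successors, and `β ∉ w` bars `w` and its
  -- predecessors.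
  have hzig : ∀ w v, ((∃ u, C.R w u ∧ C.R v u) ∨ ∃ u, C.R u w ∧ C.R u v) →
      C.R w v ∨ C.R v w := by
    intro w v huv
    by_contra! hc
    obtain ⟨h1, h2⟩ := hc
    obtain ⟨α, hα, hα'⟩ : ∃ α, box α ∈ w.1 ∧ α ∉ v.1 := by
      by_contra! h
      exact h1 h
    obtain ⟨β, hβ, hβ'⟩ : ∃ β, box β ∈ v.1 ∧ β ∉ w.1 := by
      by_contra! h
      exact h2 h
    have hv : v ∈ truth C V (conj (neg α) (box β)) :=
      (htruth _ _).2 (v.2.conj_iff.2 ⟨v.2.neg_iff.2 hα', hβ⟩)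
    have hbz := hvalid _ S43t_axioms.2.2 (fun _ => conj (neg α) (box β)) w
    simp only [bz, delta, Formula.subst, disj, dia, neg] at hbz
    simp only [← neg.eq_1, ← disj.eq_1, ← dia.eq_1] at hbz
    simp only [mem_truth_imp, mem_truth_disj, mem_truth_dia, mem_truth_pdia] at hbz
    have hw : w ∉ truth C V (conj (neg α) (box β)) := fun h =>
      hβ' (hrefl w _ (w.2.conj_iff.1 ((htruth _ _).1 h)).2)
    rcases hbz (huv.elim
      (fun ⟨u, hwu, hvu⟩ => Or.inr (Or.inl ⟨u, hwu, Or.inr (Or.inr ⟨v, hvu, hv⟩)⟩))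
      fun ⟨u, huw, huv⟩ => Or.inr (Or.inr ⟨u, huw, Or.inr (Or.inl ⟨v, huv, hv⟩)⟩)) with
      h | ⟨z, hz, h⟩ | ⟨z, hz, h⟩
    · exact hw h
    · exact z.2.neg_iff.1 (z.2.conj_iff.1 ((htruth _ _).1 h)).1 (hz _ hα)
    · exact hβ' (hz _ (z.2.conj_iff.1 ((htruth _ _).1 h)).2)
  let x₀ : C.X := ⟨w₀, hw₀max⟩
  let K : Frame :=
    { X := {w : C.X // C.R x₀ w ∨ C.R w x₀}
      nonempty := ⟨⟨x₀, Or.inl (hrefl _)⟩⟩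
      R := fun w v => C.R w.1 v.1 }
  -- Comparability is transitive, so the points comparable to `x₀` are totally preordered and closed
  -- under `R` both ways.
  have hlin : ∀ w v u : C.X, (C.R w v ∨ C.R v w) → (C.R v u ∨ C.R u v) → C.R w u ∨ C.R u w := by
    rintro w v u (h1 | h1) (h2 | h2)
    · exact Or.inl (htrans _ _ _ h1 h2)
    · exact hzig _ _ (Or.inl ⟨v, h1, h2⟩)
    · exact hzig _ _ (Or.inr ⟨v, h1, h2⟩)
    · exact Or.inr (htrans _ _ _ h2 h1)
  have hp : IsPMorphism K C Subtype.val :=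
    ⟨fun _ _ h => h, fun x y h => ⟨⟨y, hlin _ _ _ x.2 (Or.inl h)⟩, h, rfl⟩,
      fun x y h => ⟨⟨y, hlin _ _ _ x.2 (Or.inr h)⟩, h, rfl⟩⟩
  have hKtruth : ∀ ψ (x : K.X), x ∈ truth K (fun i => {x | x.1 ∈ V i}) ψ ↔ ψ ∈ x.1.1 :=
    fun ψ x => (hp.mem_truth ψ (fun _ _ _ => Iff.rfl) x).trans (htruth _ _)
  refine ⟨K, fun i => {x | x.1 ∈ V i}, ⟨⟨fun x => hrefl x.1, fun x y z => htrans x.1 y.1 z.1,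
    fun x y => hlin _ _ _ x.2.symm y.2⟩, fun x y h => ?_, fun ψ hψ x => ?_⟩,
    ⟨x₀, Or.inl (hrefl _)⟩, fun h => hφw ((hKtruth _ _).1 h)⟩
  · simp only [hKtruth] at h
    refine Subtype.ext (Subtype.ext (Set.Subset.antisymm h fun ψ hψ => ?_))
    by_contra hc
    exact y.1.2.neg_iff.1 (h _ (x.1.2.neg_iff.2 hc)) hψ
  · exact (hKtruth _ _).2 (x.1.2.subset hψ)

/-- Sets of points that are the truth set of a formula. -/
def Definable (F : Frame) (V : ℕ → Set F.X) (S : Set F.X) : Prop := ∃ φ, truth F V φ = S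

section Definable

variable {F : Frame} {V : ℕ → Set F.X} {S T : Set F.X}

lemma Definable.compl (hS : Definable F V S) : Definable F V Sᶜ := by
  obtain ⟨φ, rfl⟩ := hS
  exact ⟨neg φ, by ext; simp⟩

lemma Definable.inter (hS : Definable F V S) (hT : Definable F V T) :
    Definable F V (S ∩ T) := by
  obtain ⟨φ, rfl⟩ := hS
  obtain ⟨ψ, rfl⟩ := hT
  exact ⟨conj φ ψ, by ext; simp⟩

lemma Definable.union (hS : Definable F V S) (hT : Definable F V T) :
    Definable F V (S ∪ T) := by
  obtain ⟨φ, rfl⟩ := hS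
  obtain ⟨ψ, rfl⟩ := hT
  exact ⟨disj φ ψ, by ext; simp⟩

lemma definable_empty : Definable F V ∅ := ⟨bot, rfl⟩

lemma definable_univ : Definable F V Set.univ := by
  simpa using (definable_empty (F := F) (V := V)).compl

lemma Definable.setOf_rel (hS : Definable F V S) : Definable F V {x | ∃ y ∈ S, F.R x y} := by
  obtain ⟨φ, rfl⟩ := hS
  exact ⟨dia φ, by ext; simp [and_comm]⟩

lemma Definable.setOf_rel_flip (hS : Definable F V S) : Definable F V {x | ∃ y ∈ S, F.R y x} := by
  obtain ⟨φ, rfl⟩ := hS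
  exact ⟨pdia φ, by ext; simp [and_comm]⟩

lemma definable_biUnion {ι : Type*} {A : Set ι} (hA : A.Finite) {D : ι → Set F.X}
    (hD : ∀ i ∈ A, Definable F V (D i)) : Definable F V (⋃ i ∈ A, D i) := by
  induction A, hA using Set.Finite.induction_on with
  | empty => simpa using definable_empty
  | insert _ _ ih =>
    rw [Set.biUnion_insert]
    exact (hD _ (Set.mem_insert _ _)).union (ih fun i hi => hD i (Set.mem_insert_of_mem _ hi))

lemma definable_iUnion {ι : Type*} [Finite ι] {D : ι → Set F.X}
    (hD : ∀ i, Definable F V (D i)) : Definable F V (⋃ i, D i) := by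
  simpa using definable_biUnion (Set.toFinite Set.univ) fun i _ => hD i

lemma definable_iInter {ι : Type*} [Finite ι] {D : ι → Set F.X}
    (hD : ∀ i, Definable F V (D i)) : Definable F V (⋂ i, D i) := by
  simpa [Set.compl_iUnion] using (definable_iUnion fun i => (hD i).compl).compl

/-- Boolean combinations of finitely many definable sets are definable. -/
lemma definable_setOf_mem {ι : Type*} [Finite ι] {D : ι → Set F.X}
    (hD : ∀ i, Definable F V (D i)) (P : Set (Set ι)) :
    Definable F V {x | {i | x ∈ D i} ∈ P} := by
  have h : {x | {i | x ∈ D i} ∈ P} = ⋃ A ∈ P, ⋂ i, {x | x ∈ D i ↔ i ∈ A} := by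
    ext x
    simp only [Set.mem_ofPred_eq, Set.mem_iUnion, Set.mem_iInter, exists_prop]
    refine ⟨fun h => ⟨_, h, fun i => Iff.rfl⟩, fun ⟨A, hA, hx⟩ => ?_⟩
    rwa [show {i | x ∈ D i} = A from Set.ext hx]
  rw [h]
  refine definable_biUnion (Set.toFinite P) fun A _ => definable_iInter fun i => ?_
  by_cases hi : i ∈ A
  · simpa [hi] using hD i
  · simp only [hi, iff_false]
    exact (hD i).compl

end Definable

namespace IsLinearModel

variable {L : Set Formula} {F : Frame} {V : ℕ → Set F.X}

lemma exists_definable (h : IsLinearModel L F V) {x y : F.X} (hxy : x ≠ y) :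
    ∃ S, Definable F V S ∧ x ∈ S ∧ y ∉ S := by
  by_contra! hc
  exact hxy (h.differentiated x y fun φ hφ => hc _ ⟨φ, rfl⟩ hφ)

/-- A finite set of points can be separated by a definable partition. -/
lemma exists_retraction (h : IsLinearModel L F V) {Y : Type} [Finite Y] [Nonempty Y]
    {pt : Y → F.X} (hpt : Function.Injective pt) :
    ∃ f : F.X → Y, (∀ y, f (pt y) = y) ∧ ∀ T, Definable F V (f ⁻¹' T) := by
  have hD : ∀ p : Y × Y, ∃ S, Definable F V S ∧ (p.1 ≠ p.2 → pt p.1 ∈ S ∧ pt p.2 ∉ S) := by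
    intro p
    by_cases hp : p.1 = p.2
    · exact ⟨_, definable_univ, fun h => absurd hp h⟩
    · obtain ⟨S, hS, hS'⟩ := h.exists_definable (hpt.ne hp)
      exact ⟨S, hS, fun _ => hS'⟩
  choose D hD hsep using hD
  have hinj : Function.Injective fun y => {p | pt y ∈ D p} := by
    intro y z hyz
    by_contra hne
    exact (hsep (y, z) hne).2 ((Set.ext_iff.1 hyz (y, z)).1 (hsep (y, z) hne).1)
  -- A point goes to the `y` with the same membership pattern in the separating sets; patterns of no
  -- `pt y` get a default value.
  exact ⟨fun x => Function.invFun (fun y => {p | pt y ∈ D p}) {p | x ∈ D p},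
    Function.leftInverse_invFun hinj, fun T => definable_setOf_mem hD (Function.invFun _ ⁻¹' T)⟩

/-- The frame `F` itself need not validate `L`. Since every valuation on `G` pulls back to definable
sets, truth in `G` becomes truth of a substitution instance in the one model given. -/
lemma subset_log_of_isPMorphism (h : IsLinearModel L F V) (hL : IsTenseLogic L) {G : Frame}
    {f : F.X → G.X} (hf : IsPMorphism F G f) (hsurj : Function.Surjective f)
    (hdef : ∀ T, Definable F V (f ⁻¹' T)) : L ⊆ Log G := by
  intro φ hφ W y
  obtain ⟨x, rfl⟩ := hsurj y
  choose s hs using fun i => hdef (W i)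
  exact (hf.mem_truth_subst φ (fun i _ x => by rw [hs]; rfl) x).1
    (h.valid _ (hL.subst _ hφ s) x)

lemma subset_log_of_finite (h : IsLinearModel L F V) (hL : IsTenseLogic L) [Finite F.X] :
    L ⊆ Log F := by
  have := F.nonempty
  obtain ⟨f, hf, hdef⟩ := h.exists_retraction (pt := id) Function.injective_id
  obtain rfl : f = id := funext hf
  exact h.subset_log_of_isPMorphism hL
    ⟨fun _ _ h => h, fun _ y h => ⟨y, h, rfl⟩, fun _ y h => ⟨y, h, rfl⟩⟩
    Function.surjective_id hdef

end IsLinearModel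

/-! ### Disjoint unions and tabularity from bounded models. -/

lemma IsPMorphism.id_of_iff {F G : Frame} (e : F.X ≃ G.X) (he : ∀ x y, F.R x y ↔ G.R (e x) (e y)) :
    IsPMorphism F G e :=
  ⟨fun x y => (he x y).1, fun x y h => ⟨e.symm y, (he _ _).2 (by simpa using h), by simp⟩,
    fun x y h => ⟨e.symm y, (he _ _).2 (by simpa using h), by simp⟩⟩

lemma IsPMorphism.log_subset {F G : Frame} {f : F.X → G.X} (hf : IsPMorphism F G f)
    (hsurj : Function.Surjective f) : Log F ⊆ Log G := by
  intro φ hφ W y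
  obtain ⟨x, rfl⟩ := hsurj y
  exact (hf.mem_truth φ (V := fun i => f ⁻¹' W i) (fun _ _ _ => Iff.rfl) x).1 (hφ _ x)

/-- The disjoint union of frames. -/
abbrev disjointUnion {ι : Type} [Nonempty ι] (F : ι → Frame) : Frame where
  X := Σ i, (F i).X
  nonempty := ‹Nonempty ι›.elim fun i => (F i).nonempty.elim fun x => ⟨⟨i, x⟩⟩
  R a b := ∃ h : a.1 = b.1, (F b.1).R (h ▸ a.2) b.2

lemma isPMorphism_disjointUnion {ι : Type} [Nonempty ι] (F : ι → Frame) (i : ι) :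
    IsPMorphism (F i) (disjointUnion F) (fun x => ⟨i, x⟩) := by
  refine ⟨fun x y h => ⟨rfl, h⟩, ?_, ?_⟩
  · rintro x ⟨j, y⟩ ⟨h, hR⟩
    obtain rfl : i = j := h
    exact ⟨y, hR, rfl⟩
  · rintro x ⟨j, y⟩ ⟨h, hR⟩
    obtain rfl : j = i := h
    exact ⟨y, hR, rfl⟩

lemma mem_log_disjointUnion {ι : Type} [Nonempty ι] {F : ι → Frame} {φ : Formula} :
    φ ∈ Log (disjointUnion F) ↔ ∀ i, φ ∈ Log (F i) := by
  constructor
  · intro h i V x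
    refine ((isPMorphism_disjointUnion F i).mem_truth φ
      (W := fun k => {p | ∃ y ∈ V k, p = ⟨i, y⟩}) (fun k _ y => ?_) x).2 (h _ _)
    refine ⟨fun hy => ⟨y, hy, rfl⟩, ?_⟩
    rintro ⟨z, hz, h⟩
    obtain rfl : y = z := by simpa using h
    exact hz
  · rintro h V ⟨i, x⟩
    exact ((isPMorphism_disjointUnion F i).mem_truth φ
      (V := fun k => {x | (⟨i, x⟩ : Σ i, (F i).X) ∈ V k}) (fun _ _ _ => Iff.rfl) x).1 (h i _ x)

/-- Up to isomorphism only finitely many frames arise, so the disjoint union of those validating `L`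
is finite. Consistency makes it nonempty. -/
lemma isTabular_of_bounded {L : Set Formula} (hL : IsTenseLogic L) (hS : S43t ⊆ L)
    (hcons : Consistent L) (N : ℕ)
    (hN : ∀ F V, IsLinearModel L F V → Finite F.X ∧ Nat.card F.X ≤ N) : IsTabular L := by
  let mk : (Σ n : Fin (N + 1), Fin (n + 1) → Fin (n + 1) → Prop) → Frame :=
    fun p => ⟨Fin (p.1 + 1), ⟨0⟩, p.2⟩
  let ι := {p // L ⊆ Log (mk p)}
  have key : ∀ φ ∉ L, ∃ i : ι, φ ∉ Log (mk i.1) := by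
    intro φ hφ
    obtain ⟨F, V, hF, x, hx⟩ := exists_isLinearModel_of_notMem hL hS hφ
    obtain ⟨hfin, hcard⟩ := hN F V hF
    have := F.nonempty
    have hpos : 0 < Nat.card F.X := Nat.card_pos
    obtain ⟨n, hn⟩ : ∃ n : Fin (N + 1), Nat.card F.X = n + 1 :=
      ⟨⟨Nat.card F.X - 1, by omega⟩, by simp only; omega⟩
    let e : F.X ≃ Fin (n + 1) := (Finite.equivFin F.X).trans (finCongr hn)
    let p : Σ n : Fin (N + 1), Fin (n + 1) → Fin (n + 1) → Prop :=
      ⟨n, fun a b => F.R (e.symm a) (e.symm b)⟩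
    have he : IsPMorphism F (mk p) e := .id_of_iff (G := mk p) e (by simp [mk, p])
    have he' : IsPMorphism (mk p) F e.symm := .id_of_iff (F := mk p) e.symm (fun _ _ => Iff.rfl)
    exact ⟨⟨p, (hF.subset_log_of_finite hL).trans (he.log_subset e.surjective)⟩,
      fun h => hx (he'.log_subset e.symm.surjective h V x)⟩
  have hι : Nonempty ι := (key _ hcons).nonempty
  refine ⟨disjointUnion fun i : ι => mk i.1, ?_, ?_⟩
  · have : ∀ i : ι, Finite (mk i.1).X := fun i => inferInstanceAs (Finite (Fin _))
    infer_instance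
  · ext φ
    rw [mem_log_disjointUnion]
    refine ⟨fun h i => i.2 h, fun h => ?_⟩
    by_contra hc
    obtain ⟨i, hi⟩ := key φ hc
    exact hi (h i)

lemma finite_or_exists_injective (α : Type*) (n : ℕ) :
    (Finite α ∧ Nat.card α ≤ n) ∨ ∃ e : Fin (n + 1) → α, Function.Injective e := by
  rcases finite_or_infinite α with h | h
  · refine or_iff_not_imp_left.2 fun hn => ?_
    have hlt : n + 1 ≤ Nat.card α := by
      by_contra hc
      exact hn ⟨h, by omega⟩
    exact ⟨fun i => (Finite.equivFin α).symm (Fin.castLE hlt i),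
      (Finite.equivFin α).symm.injective.comp (Fin.castLE_injective hlt)⟩
  · exact Or.inr ⟨fun i => Infinite.natEmbedding α i,
      (Infinite.natEmbedding α).injective.comp Fin.val_injective⟩

/-- Between different ranks totality and monotonicity already give the lifting; only points of equal
rank need care. -/
lemma isPMorphism_of_isRanked {α : Type} [LinearOrder α] {F G : Frame} {r : G.X → α}
    (hF : IsLinear F) (hr : IsRanked G r) {f : F.X → G.X} (hsurj : Function.Surjective f)
    (hmono : ∀ x y, F.R x y → r (f y) ≤ r (f x))
    (hloc : ∀ x y, r (f x) = r (f y) →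
      (∃ z, F.R x z ∧ f z = f y) ∧ ∃ z, F.R z x ∧ f z = f y) : IsPMorphism F G f := by
  refine ⟨fun x y h => (hr _ _).2 (hmono x y h), fun x y h => ?_, fun x y h => ?_⟩ <;>
    obtain ⟨y, rfl⟩ := hsurj y
  · rcases ((hr _ _).1 h).lt_or_eq with h | h
    · exact ⟨y, (hF.total x y).resolve_right fun hc => (hmono _ _ hc).not_gt h, rfl⟩
    · exact (hloc x y h.symm).1
  · rcases ((hr _ _).1 h).lt_or_eq with h | h
    · exact ⟨y, (hF.total y x).resolve_right fun hc => (hmono _ _ hc).not_gt h, rfl⟩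
    · exact (hloc x y h).2

/-! ### Definable upsets and maps onto chains. -/

/-- The definable sets closed under successors. -/
abbrev DefinableUpset (F : Frame) (V : ℕ → Set F.X) : Type :=
  {U : Set F.X // Definable F V U ∧ ∀ x y, F.R x y → x ∈ U → y ∈ U}

namespace IsLinearModel

variable {L : Set Formula} {F : Frame} {V : ℕ → Set F.X}

lemma upset_total (h : IsLinearModel L F V) (U W : DefinableUpset F V) : U ≤ W ∨ W ≤ U := by
  by_contra! hc
  obtain ⟨x, hxU, hxW⟩ := Set.not_subset.1 hc.1
  obtain ⟨y, hyW, hyU⟩ := Set.not_subset.1 hc.2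
  rcases h.linear.total x y with hxy | hxy
  · exact hyU (U.2.2 _ _ hxy hxU)
  · exact hxW (W.2.2 _ _ hxy hyW)

open Classical in
lemma subset_log_chain (h : IsLinearModel L F V) (hL : IsTenseLogic L) {n : ℕ}
    {e : Fin (n + 2) → DefinableUpset F V} (he : Function.Injective e) : L ⊆ Log (chain n) := by
  let _ : LinearOrder (DefinableUpset F V) :=
    { (inferInstance : PartialOrder (DefinableUpset F V)) with
      le_total := h.upset_total
      toDecidableLE := Classical.decRel _ }
  obtain ⟨U, hU⟩ : ∃ U : Fin (n + 2) → DefinableUpset F V, StrictMono U :=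
    ⟨_, ((Finset.univ.map ⟨e, he⟩).orderEmbOfFin (k := n + 2) (by simp)).strictMono⟩
  have hpt : ∀ j : Fin (n + 1), ∃ x, x ∈ (U j.succ).1 ∧ x ∉ (U j.castSucc).1 := fun j =>
    Set.not_subset.1 (hU (Fin.castSucc_lt_succ (i := j))).not_ge
  let count : Set (Fin n) → Fin (n + 1) := fun A =>
    ⟨(Finset.univ.filter fun i => i ∉ A).card,
      Nat.lt_succ_of_le ((Finset.card_le_univ _).trans_eq (Fintype.card_fin n))⟩
  -- Only the `n` inner upsets are counted: points of `U 0` join the lowest layer and points outside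
  -- the largest upset join the highest. The two outer upsets serve to make these layers nonempty.
  let ρ : F.X → Fin (n + 1) := fun x => count {i | x ∈ (U i.castSucc.succ).1}
  have hsurj : Function.Surjective ρ := by
    intro j
    obtain ⟨x, hx, hx'⟩ := hpt j
    have hiff : ∀ i : Fin n, x ∉ (U i.castSucc.succ).1 ↔ (i : ℕ) < j := by
      intro i
      constructor
      · intro hi
        by_contra hc
        exact hi (hU.monotone (by simp only [Fin.le_def, Fin.val_succ, Fin.val_castSucc]; omega) hx)
      · intro hi hc
        exact hx' (hU.monotone (by simp only [Fin.le_def, Fin.val_succ, Fin.val_castSucc]; omega) hc)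
    refine ⟨x, Fin.ext ?_⟩
    simp only [ρ, count, Set.mem_ofPred_eq, hiff, Fin.card_filter_val_lt]
    omega
  have hmono : ∀ x y, F.R x y → ρ y ≤ ρ x := by
    intro x y hxy
    simp only [ρ, count, Fin.mk_le_mk]
    refine Finset.card_le_card (Finset.monotone_filter_right _ fun i _ hi hc => hi ?_)
    exact (U _).2.2 _ _ hxy hc
  refine h.subset_log_of_isPMorphism hL (f := ρ) ?_ hsurj fun T =>
    definable_setOf_mem (fun i => (U _).2.1) (count ⁻¹' T)
  exact isPMorphism_of_isRanked h.linear (isRanked_chain n) hsurj hmono fun x y hxy =>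
    ⟨⟨x, h.linear.refl x, hxy⟩, x, h.linear.refl x, hxy⟩

end IsLinearModel

/-! ### Trichotomies: one large type between its past and its future. -/

/-- `ρ` divides the model into three intervals, the middle one of which has no definable nontrivial
upsets and contains `m` distinct points. -/
structure IsTrichotomy (F : Frame) (V : ℕ → Set F.X) (ρ : F.X → Fin 3) (m : ℕ) : Prop where
  mono : ∀ x y, F.R x y → ρ y ≤ ρ x
  definable : ∀ T, Definable F V (ρ ⁻¹' T)
  middle : ∀ S, Definable F V S → ∀ x y, ρ x = 1 → ρ y = 1 → y ∈ S →
    (∃ z ∈ S, F.R x z) ∧ ∃ z ∈ S, F.R z x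
  exists_injective : ∃ pt : Fin m → F.X, Function.Injective pt ∧ ∀ i, ρ (pt i) = 1

namespace IsLinearModel

variable {L : Set Formula} {F : Frame} {V : ℕ → Set F.X}

open Classical in
lemma exists_isTrichotomy (h : IsLinearModel L F V) {n m : ℕ} [Finite (DefinableUpset F V)]
    (hn : Nat.card (DefinableUpset F V) ≤ n) {e : Fin (2 ^ n * m + 1) → F.X}
    (he : Function.Injective e) : ∃ ρ, IsTrichotomy F V ρ m := by
  let t : F.X → Set (DefinableUpset F V) := fun x => {U | x ∈ U.1}
  have := Fintype.ofFinite (DefinableUpset F V)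
  -- There are at most `2 ^ n` types, so some type is shared by more than `m` of the points.
  obtain ⟨A, hA⟩ := Fintype.exists_lt_card_fiber_of_mul_lt_card (n := m) (fun i => t (e i)) (by
    rw [Fintype.card_set, Fintype.card_fin, ← Nat.card_eq_fintype_card]
    exact Nat.lt_succ_of_le (Nat.mul_le_mul_right _ (Nat.pow_le_pow_right two_pos hn)))
  obtain ⟨i₀, hi₀⟩ := Finset.card_pos.1 (Nat.zero_lt_of_lt hA)
  obtain rfl : t (e i₀) = A := (Finset.mem_filter.1 hi₀).2
  let cls : Set (DefinableUpset F V) → Fin 3 := fun B =>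
    if B = t (e i₀) then 1 else if t (e i₀) ⊆ B then 0 else 2
  have hmid : ∀ x, cls (t x) = 1 ↔ t x = t (e i₀) := by
    intro x
    simp only [cls]
    split_ifs <;> simp_all
  have ht : ∀ x y, F.R x y → t x ⊆ t y := fun x y hxy U hU => U.2.2 _ _ hxy hU
  refine ⟨fun x => cls (t x), fun x y hxy => ?_, fun T => definable_setOf_mem (fun U => U.2.1)
    (cls ⁻¹' T), fun S hS x y hx hy hyS => ?_, ?_⟩
  · have h1 := ht x y hxy
    by_cases hx : t x = t (e i₀)
    · simp only [cls, hx, if_true]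
      split_ifs with h2 h3
      exacts [le_rfl, by decide, absurd (hx ▸ h1) h3]
    · by_cases hx' : t (e i₀) ⊆ t x
      · have hy : t y ≠ t (e i₀) := fun hy => hx ((hy ▸ h1).antisymm hx')
        simp only [cls, hy, hx, hx', hx'.trans h1, if_true, if_false, le_refl]
      · simp only [cls, hx, hx', if_false]
        exact Fin.le_last _
  · rw [hmid] at hx hy
    have hxy : t x = t y := hx.trans hy.symm
    constructor
    · by_contra hc
      -- Points that cannot reach `S` form a definable upset, which would separate `x` from `y`.
      -- Points reachable from `S` serve for the past.
      have hU : Definable F V {x | ∃ y ∈ S, F.R x y}ᶜ := hS.setOf_rel.compl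
      exact ((Set.ext_iff.1 hxy ⟨_, hU, fun a b hab ha ⟨z, hz, hbz⟩ =>
        ha ⟨z, hz, h.linear.trans _ _ _ hab hbz⟩⟩).1 hc) ⟨y, hyS, h.linear.refl y⟩
    · exact (Set.ext_iff.1 hxy ⟨_, hS.setOf_rel_flip, fun a b hab ⟨z, hz, hza⟩ =>
        ⟨z, hz, h.linear.trans _ _ _ hza hab⟩⟩).2 ⟨y, hyS, h.linear.refl y⟩
  · obtain ⟨s, hs, hcard⟩ := Finset.exists_subset_card_eq hA.le
    refine ⟨fun i => e (s.orderEmbOfFin hcard i), he.comp (s.orderEmbOfFin hcard).injective,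
      fun i => (hmid _).2 ?_⟩
    exact (Finset.mem_filter.1 (hs (s.orderEmbOfFin_mem hcard i))).2

lemma subset_log_of_isTrichotomy (h : IsLinearModel L F V) (hL : IsTenseLogic L) {m : ℕ}
    {ρ : F.X → Fin 3} (hρ : IsTrichotomy F V ρ m) {G : Frame} [Finite G.X] {r : G.X → Fin 3}
    (hr : IsRanked G r) (hrange : Set.range r = Set.range ρ) (hone : ∃ y, r y = 1)
    (hsub : ∀ x y, r x = r y → r x ≠ 1 → x = y) (hm : Nat.card G.X ≤ m) : L ⊆ Log G := by
  obtain ⟨pt, hpt, hpt1⟩ := hρ.exists_injective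
  have : Nonempty {y // r y = 1} := hone.elim fun y hy => ⟨⟨y, hy⟩⟩
  let ix : {y // r y = 1} → Fin m := fun y => Fin.castLE hm (Finite.equivFin G.X y.1)
  have hix : Function.Injective ix :=
    (Fin.castLE_injective hm).comp ((Finite.equivFin G.X).injective.comp Subtype.val_injective)
  obtain ⟨f₁, hf₁, hdef⟩ := h.exists_retraction (hpt.comp hix)
  choose g hg using fun x => (hrange ▸ Set.mem_range_self x : ρ x ∈ Set.range r)
  classical
  let f : F.X → G.X := fun x => if ρ x = 1 then (f₁ x).1 else g x
  have hrf : ∀ x, r (f x) = ρ x := by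
    intro x
    by_cases hx : ρ x = 1
    · simp only [f, hx, if_true, (f₁ x).2]
    · simp only [f, hx, if_false, hg]
  have hf1 : ∀ x, ρ x = 1 → f x = (f₁ x).1 := fun x hx => by simp only [f, hx, if_true]
  have hsurj : Function.Surjective f := by
    intro y
    by_cases hy : r y = 1
    · exact ⟨pt (ix ⟨y, hy⟩), by rw [hf1 _ (hpt1 _)]; exact congrArg Subtype.val (hf₁ ⟨y, hy⟩)⟩
    · obtain ⟨x, hx⟩ : r y ∈ Set.range ρ := hrange ▸ Set.mem_range_self y
      exact ⟨x, hsub _ _ (by rw [hrf, hx]) (by rwa [hrf, hx])⟩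
  refine h.subset_log_of_isPMorphism hL (f := f) ?_ hsurj fun T => ?_
  · refine isPMorphism_of_isRanked h.linear hr hsurj
      (fun x y hxy => by rw [hrf, hrf]; exact hρ.mono x y hxy) fun x y hxy => ?_
    rw [hrf, hrf] at hxy
    by_cases hx : ρ x = 1
    · have hy : ρ y = 1 := hxy ▸ hx
      -- The fibre of `f` over `f y` is definable and meets the middle interval, so `x` sees it in
      -- both directions.
      have hS := (hρ.definable {1}).inter (hdef {f₁ y})
      have hz : ∀ z ∈ ρ ⁻¹' {1} ∩ f₁ ⁻¹' {f₁ y}, f z = f y := fun z hz => by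
        rw [hf1 z hz.1, hf1 y hy, hz.2]
      obtain ⟨⟨a, ha, hxa⟩, b, hb, hbx⟩ := hρ.middle _ hS x y hx hy ⟨hy, rfl⟩
      exact ⟨⟨a, hxa, hz a ha⟩, b, hbx, hz b hb⟩
    · have hfxy : f x = f y := hsub _ _ (by rw [hrf, hrf, hxy]) (by rwa [hrf])
      exact ⟨⟨x, h.linear.refl x, hfxy⟩, x, h.linear.refl x, hfxy⟩
  · have hT : f ⁻¹' T = ρ ⁻¹' {1} ∩ f₁ ⁻¹' (Subtype.val ⁻¹' T) ∪
        ρ ⁻¹' {a | a ≠ 1 ∧ ∃ y ∈ T, r y = a} := by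
      ext x
      by_cases hx : ρ x = 1
      · simp [hf1 x hx, hx]
      · simp only [Set.mem_preimage, Set.mem_union, Set.mem_inter_iff, Set.mem_singleton_iff, hx,
          false_and, false_or, Set.mem_ofPred_eq, ne_eq, not_false_eq_true, true_and]
        refine ⟨fun hxT => ⟨f x, hxT, hrf x⟩, ?_⟩
        rintro ⟨y, hy, hyx⟩
        rwa [hsub (f x) y (by rw [hrf, hyx]) (by rwa [hrf])]
    rw [hT]
    exact ((hρ.definable _).inter (hdef _)).union (hρ.definable _)

end IsLinearModel

/-! ### From large trichotomies to the five logics. -/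

/-- `L` has models with trichotomies of shape `A` whose middle intervals are arbitrarily large. -/
def HasTrichotomies (L : Set Formula) (A : Set (Fin 3)) (m : ℕ) : Prop :=
  ∃ F V ρ, IsLinearModel L F V ∧ IsTrichotomy F V ρ m ∧ Set.range ρ = A

lemma HasTrichotomies.mono {L : Set Formula} {A : Set (Fin 3)} {m k : ℕ}
    (h : HasTrichotomies L A m) (hk : k ≤ m) : HasTrichotomies L A k := by
  obtain ⟨F, V, ρ, hF, hρ, hA⟩ := h
  obtain ⟨pt, hpt, hpt1⟩ := hρ.exists_injective
  exact ⟨F, V, ρ, hF, ⟨hρ.mono, hρ.definable, hρ.middle, fun i => pt (Fin.castLE hk i),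
    hpt.comp (Fin.castLE_injective hk), fun i => hpt1 _⟩, hA⟩

lemma subset_log_of_hasTrichotomies {L : Set Formula} (hL : IsTenseLogic L) {G : Frame}
    {r : G.X → Fin 3} (h : ∀ m, HasTrichotomies L (Set.range r) m) (hr : IsRanked G r)
    (hone : ∃ y, r y = 1) (hsub : ∀ x y, r x = r y → r x ≠ 1 → x = y) : L ⊆ Log G := by
  intro φ hφ W x
  -- Points of equal rank that agree on the variables of `φ` are identified; the quotient is finite,
  -- and its size dictates the middle interval needed.
  let q : G.X → Fin 3 × Set (Fin (varBound φ)) := fun y => (r y, {i | y ∈ W i})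
  let H : Frame := ⟨Set.range q, ⟨⟨_, x, rfl⟩⟩, fun a b => b.1.1 ≤ a.1.1⟩
  have hsurj : Function.Surjective (Set.rangeFactorization q) := Set.rangeFactorization_surjective
  have hHr : IsRanked H (fun a => a.1.1) := fun _ _ => Iff.rfl
  have hq : IsPMorphism G H (Set.rangeFactorization q) :=
    isPMorphism_of_isRanked hr.isLinear hHr hsurj (fun a b => (hr a b).1) fun a b hab =>
      ⟨⟨b, (hr a b).2 hab.ge, rfl⟩, b, (hr b a).2 hab.le, rfl⟩
  have : Finite H.X := inferInstanceAs (Finite (Set.range q))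
  obtain ⟨F, V, ρ, hF, hρ, hrange⟩ := h (Nat.card H.X)
  have hH : L ⊆ Log H := by
    refine hF.subset_log_of_isTrichotomy hL hρ hHr ?_ ?_ ?_ le_rfl
    · rw [hrange, ← hsurj.range_comp]
      rfl
    · exact hone.elim fun y hy => ⟨⟨q y, y, rfl⟩, hy⟩
    · rintro ⟨_, a, rfl⟩ ⟨_, b, rfl⟩ hab ha
      rw [hsub a b hab ha]
  exact (hq.mem_truth φ (V := W) (W := fun i => {y | ∃ hi : i < varBound φ, ⟨i, hi⟩ ∈ y.1.2})
    (fun i hi y => ⟨fun hy => ⟨hi, hy⟩, fun ⟨_, hy⟩ => hy⟩) x).2 (hH hφ _ _)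

lemma subset_log_inflate {L : Set Formula} (hL : IsTenseLogic L) {A : Set (Fin 3)}
    (h : ∀ m, HasTrichotomies L A m) {n : ℕ} (c : Fin (n + 1)) (σ : Fin (n + 1) → Fin 3)
    (hσ : StrictMono σ) (hc : σ c = 1) (hA : ∀ a, a ∈ A ↔ ∃ u, σ u = a) :
    L ⊆ Log (inflate (chain n) c) := by
  have hsurj : Function.Surjective (inflateRank c) := fun u => ⟨Sum.inl u, rfl⟩
  refine subset_log_of_hasTrichotomies hL (r := fun x => σ (inflateRank c x)) ?_
    (fun x y => (isRanked_inflate c x y).trans hσ.le_iff_le.symm) ⟨Sum.inr 0, hc⟩ ?_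
  · rwa [show Set.range (fun x => σ (inflateRank c x)) = A from
      (hsurj.range_comp σ).trans (Set.ext fun a => (hA a).symm)]
  · intro x y hxy hx
    have hxy := hσ.injective hxy
    rcases x with x | x
    · rcases y with y | y
      · exact congrArg Sum.inl hxy
      · exact absurd ((congrArg σ hxy).trans hc) hx
    · exact absurd hc hx

lemma exists_subset_fiveLogics {L : Set Formula} (hL : IsTenseLogic L) (hS : S43t ⊆ L)
    (hcons : Consistent L) (htab : ¬ IsTabular L) : ∃ i, L ⊆ fiveLogics i := by
  by_cases hup : ∀ n, L ⊆ Log (chain n)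
  · exact ⟨4, Set.subset_iInter hup⟩
  obtain ⟨n, hn⟩ := not_forall.1 hup
  have hmany : ∀ m, ∃ A, HasTrichotomies L A m := by
    intro m
    by_contra hc
    refine htab (isTabular_of_bounded hL hS hcons (2 ^ (n + 1) * m) fun F V hF => ?_)
    refine (finite_or_exists_injective _ _).resolve_right fun ⟨e, he⟩ => hc ?_
    obtain ⟨hfin, hcard⟩ := (finite_or_exists_injective (DefinableUpset F V) (n + 1)).resolve_right
      fun ⟨d, hd⟩ => hn (hF.subset_log_chain hL hd)
    obtain ⟨ρ, hρ⟩ := hF.exists_isTrichotomy hcard he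
    exact ⟨_, F, V, ρ, hF, hρ, rfl⟩
  -- There are finitely many shapes: if each failed from some size on, none would exist at the
  -- largest of these sizes.
  obtain ⟨A, hA⟩ : ∃ A, ∀ m, HasTrichotomies L A m := by
    by_contra! hc
    choose m hm using hc
    obtain ⟨A, hA⟩ := hmany (Finset.univ.sup m)
    exact hm A (hA.mono (Finset.le_sup (Finset.mem_univ A)))
  have h1 : 1 ∈ A := by
    obtain ⟨F, V, ρ, hF, hρ, rfl⟩ := hA 1
    obtain ⟨pt, -, hpt⟩ := hρ.exists_injective
    exact ⟨_, hpt 0⟩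
  have hext : ∀ {P : Fin 3 → Prop}, (0 ∈ A ↔ P 0) → P 1 → (2 ∈ A ↔ P 2) → ∀ a, a ∈ A ↔ P a := by
    intro P h0 hP h2 a
    fin_cases a
    exacts [h0, iff_of_true h1 hP, h2]
  -- Rank `0` is the future of the cluster and rank `2` its past.
  by_cases h0 : 0 ∈ A <;> by_cases h2 : 2 ∈ A
  · exact ⟨0, subset_log_inflate hL hA 1 (fun u => u) strictMono_id rfl
      (hext (iff_of_true h0 (by decide)) (by decide) (iff_of_true h2 (by decide)))⟩
  · exact ⟨1, subset_log_inflate hL hA 1 Fin.castSucc Fin.strictMono_castSucc rfl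
      (hext (iff_of_true h0 (by decide)) (by decide) (iff_of_false h2 (by decide)))⟩
  · exact ⟨2, subset_log_inflate hL hA 0 Fin.succ Fin.strictMono_succ rfl
      (hext (iff_of_false h0 (by decide)) (by decide) (iff_of_true h2 (by decide)))⟩
  · exact ⟨3, subset_log_inflate hL hA 0 (fun _ => 1) (by decide) rfl
      (hext (iff_of_false h0 (by decide)) (by decide) (iff_of_false h2 (by decide)))⟩

lemma PTAB_S43t_eq_range : PTAB S43t = Set.range fiveLogics := by
  ext L
  constructor
  · rintro ⟨hS, hL⟩
    obtain ⟨i, hi⟩ := exists_subset_fiveLogics hL.logic hS hL.consistent hL.not_tabular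
    refine ⟨i, ?_⟩
    by_contra hne
    exact not_isTabular_fiveLogics i (hL.extensions _ (isTenseLogic_fiveLogics i)
      (hi.ssubset_of_ne (Ne.symm hne)) (consistent_fiveLogics i))
  · rintro ⟨i, rfl⟩
    refine ⟨S43t_subset_fiveLogics i, isTenseLogic_fiveLogics i, consistent_fiveLogics i,
      not_isTabular_fiveLogics i, fun L' hL' hss hcons => ?_⟩
    by_contra htab
    obtain ⟨j, hj⟩ :=
      exists_subset_fiveLogics hL' ((S43t_subset_fiveLogics i).trans hss.subset) hcons htab
    obtain rfl := eq_of_fiveLogics_subset (hss.subset.trans hj)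
    exact hss.not_subset hj

end TenseLogic

theorem mainTheorem3 :
    TenseLogic.PTAB TenseLogic.S43t =
        {TenseLogic.Lpm, TenseLogic.Lplus, TenseLogic.Lminus, TenseLogic.Lcirc,
          TenseLogic.Lup} ∧
      (TenseLogic.PTAB TenseLogic.S43t).ncard = 5 := by
  rw [TenseLogic.PTAB_S43t_eq_range]
  constructor
  · ext L
    simp only [Set.mem_range, Fin.exists_fin_succ, TenseLogic.fiveLogics]
    simp [eq_comm]
  · rw [← Set.image_univ, Set.ncard_image_of_injective _ fun i j h =>
      TenseLogic.eq_of_fiveLogics_subset h.subset]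
    simp
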